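/- Let $d\ge 2$, $k\ge 1$ and $\mathcal H_L\cong\mathcal H_{A_1}\cong\mathbb C^d$, $\mathcal H_{A_2}\cong\mathcal H_{\bar A}\cong\mathbb C^k$, $A=A_1A_2$. Let $|\chi\rangle\in\mathcal H_{A_2}\otimes\mathcal H_{\bar A}$ satisfy $\operatorname{Tr}_{\bar A}|\chi\rangle\langle\chi|=I/k$, and let $V^{(0)}:\mathcal H_L\to\mathcal H_A\otimes\mathcal H_{\bar A}$ be an exact erasure-correcting code, i.e. $(R^{(0)}_A\otimes R^{(0)}_{\bar A})V^{(0)}|\psi\rangle=|\psi\rangle_{A_1}|\chi\rangle_{A_2\bar A}$ for all $\psi$, with unitaries $R^{(0)}_A,R^{(0)}_{\bar A}$. Let $W$ be Hermitian on $A\bar A$ and $V^{(\epsilon)}=e^{i\epsilon W}V^{(0)}$. For unitaries $R_A,R_{\bar A}$ put $$\mathcal N_{\epsilon,R}(\sigma)=\operatorname{Tr}_{A_2\bar A}\big[(R_A\otimes R_{\bar A})V^{(\epsilon)}\sigma V^{(\epsilon)\dagger}(R_A\otimes R_{\bar A})^\dagger\big],$$ and let $I_c(\mathcal N)=S(\operatorname{Tr}_r\rho)-S(\rho)$,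 $\rho=(\mathcal N\otimes \mathrm{id}_r)(|\Phi\rangle\langle\Phi|)$, with $|\Phi\rangle=d^{-1/2}\sum_i|i\rangle_L|i\rangle_r$, be the coherent information. Call $R=(R_A,R_{\bar A})$ optimal at $\epsilon$ if it maximizes $I_c(\mathcal N_{\epsilon,R})$ over all pairs of unitaries. A recovery family with effective perturbation $W_R$ ($W_R$ Hermitian) is a family of unitaries $R^{(\epsilon)}_A,R^{(\epsilon)}_{\bar A}$, $\epsilon\in\mathbb R$, equal to $R^{(0)}_A,R^{(0)}_{\bar A}$ at $\epsilon=0$, with $$(R^{(\epsilon)}_A\otimes R^{(\epsilon)}_{\bar A})\,e^{i\epsilon W}\,(R^{(0)}_A\otimes R^{(0)}_{\bar A})^\dagger=I+i\epsilon W_R+o(\epsilon)\qquad(\epsilon\to0).$$ With $J=k\operatorname{Tr}_{\bar A}\{W_R,|\chi\rangle\langle\chi|\}$ and $D=ik\operatorname{Tr}_{\bar A}[W_R,|\chi\rangle\langle\chi|]$ (operators on $A_1A_2$) define $$c_1(W_R)=\tfrac{d}{2k(d^2-1)}\Big(\operatorname{Tr}J^2-\tfrac1d\operatorname{Tr}(\operatorname{Tr}_{A_1}J)^2-\tfrac1k\operatorname{Tr}(\operatorname{Tr}_{A_2}J)^2+\tfrac1{dk}(\operatorname{Tr}J)^2\Big),$$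 $$c_2(W_R)=\tfrac{d}{2k(d^2-1)}\Big(\operatorname{Tr}D^2-\tfrac1d\operatorname{Tr}(\operatorname{Tr}_{A_1}D)^2\Big).$$ Then: (1) There is a recovery family that is optimal at every $\epsilon$ and has $c_1(W_R)=0$. (2) Let $R_{\rm opt}^{(\epsilon)}$ be any choice of an optimal recovery for every $\epsilon$. A recovery family $R^{(\epsilon)}$ satisfies $I_c(\mathcal N_{\epsilon,R_{\rm opt}^{(\epsilon)}})-I_c(\mathcal N_{\epsilon,R^{(\epsilon)}})=o(\epsilon^2\log|\epsilon|)$ as $\epsilon\to0$ (that is, it is optimal to leading order) if and only if $c_1(W_R)=0$. (In particular, every recovery family that is optimal at every $\epsilon$ has $c_1(W_R)=0$.) (3) If two recovery families satisfy $c_1(W_R)<c_1(W_{R'})$, then $I_c(\mathcal N_{\epsilon,R'^{(\epsilon)}})<I_c(\mathcal N_{\epsilon,R^{(\epsilon)}})$ for all sufficiently small $\epsilon\neq0$. (4) For every recovery family there is a Hermitian $O$ on $A$ such that replacing $R^{(\epsilon)}_A$ by $e^{i\epsilon O}R^{(\epsilon)}_A$ gives a recovery family with effective perturbation $W_R+O\otimes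 I_{\bar A}$ and $c_1(W_R+O\otimes I_{\bar A})=0$. (5) $c_2$ depends only on the encoding family $\epsilon\mapsto V^{(\epsilon)}$: it has the same value for all recovery families, and for all choices of $W,\chi,R_A^{(0)},R_{\bar A}^{(0)}$ that describe the same encoding as above. -/

import Mathlib

open Matrix Filter Topology Asymptotics
open scoped Kronecker

namespace MixedBulk

/-- Partial trace over the second tensor factor. -/
def trRight {m n : Type*} [Fintype n] (X : Matrix (m × n) (m × n) ℂ) : Matrix m m ℂ :=
  fun a b => ∑ x, X (a, x) (b, x)

/-- Partial trace over the first tensor factor. -/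
def trLeft {m n : Type*} [Fintype m] (X : Matrix (m × n) (m × n) ℂ) : Matrix n n ℂ :=
  fun x y => ∑ a, X (a, x) (a, y)

/-- Von Neumann entropy `S(ρ) = -Tr (ρ ln ρ)` of a Hermitian matrix `ρ`. -/
noncomputable def entropy {n : Type*} [Fintype n] [DecidableEq n] (ρ : Matrix n n ℂ) : ℝ :=
  (cfc Real.negMulLog ρ).trace.re

/-- The density matrix `|Φ⟩⟨Φ|` of `Φ = d^{-1/2} ∑ i, |i⟩_L |i⟩_r`. -/
noncomputable def maxEntangled (d : ℕ) : Matrix (Fin d × Fin d) (Fin d × Fin d) ℂ :=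
  fun p q => if p.1 = p.2 ∧ q.1 = q.2 then (1 / d : ℂ) else 0

/-- `N ⊗ id_r`, applied blockwise in the reference index. -/
def extendRef {l m r : Type*} (N : Matrix l l ℂ → Matrix m m ℂ)
    (X : Matrix (l × r) (l × r) ℂ) : Matrix (m × r) (m × r) ℂ :=
  fun p q => N (fun a b => X (a, p.2) (b, q.2)) p.1 q.1

/-- Coherent information of a channel `N`, evaluated on the maximally entangled input. -/
noncomputable def coherentInfo {d : ℕ} {m : Type*} [Fintype m] [DecidableEq m]
    (N : Matrix (Fin d) (Fin d) ℂ → Matrix m m ℂ) : ℝ :=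
  entropy (trRight (extendRef N (maxEntangled d))) - entropy (extendRef N (maxEntangled d))

/-- Index set of (a basis of) region `A`, which is split as `A₁ ⊗ A₂`. -/
abbrev IdxA (d k : ℕ) := Fin d × Fin k

/-- Index set of (a basis of) `A ⊗ Ā = (A₁ ⊗ A₂) ⊗ Ā`. -/
abbrev Idx (d k : ℕ) := (Fin d × Fin k) × Fin k

/-- Local recovery unitaries on `A` and on `Ā`. -/
abbrev RecA (d k : ℕ) := Matrix.unitaryGroup (IdxA d k) ℂ
abbrev RecB (k : ℕ) := Matrix.unitaryGroup (Fin k) ℂ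

/-- The product recovery `R_A ⊗ R_Ā`. -/
noncomputable def recovery {d k : ℕ} (RA : RecA d k) (RB : RecB k) :
    Matrix (Idx d k) (Idx d k) ℂ :=
  (RA : Matrix (IdxA d k) (IdxA d k) ℂ) ⊗ₖ (RB : Matrix (Fin k) (Fin k) ℂ)

/-- The channel `σ ↦ Tr_{A₂ Ā} (R V σ V† R†)` from the logical system to `A₁`. -/
noncomputable def recoveredChannel {d k : ℕ} (V : Matrix (Idx d k) (Fin d) ℂ)
    (RA : RecA d k) (RB : RecB k) (σ : Matrix (Fin d) (Fin d) ℂ) : Matrix (Fin d) (Fin d) ℂ :=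
  trRight (trRight (recovery RA RB * V * σ * Vᴴ * (recovery RA RB)ᴴ))

/-- Coherent information of the encoding `V` followed by the recovery `R_A ⊗ R_Ā`. -/
noncomputable def Ic {d k : ℕ} (V : Matrix (Idx d k) (Fin d) ℂ)
    (RA : RecA d k) (RB : RecB k) : ℝ :=
  coherentInfo (recoveredChannel V RA RB)

/-- `R_A ⊗ R_Ā` maximizes the coherent information over all local recovery unitaries. -/
def IsOptimal {d k : ℕ} (V : Matrix (Idx d k) (Fin d) ℂ) (RA : RecA d k) (RB : RecB k) : Prop :=
  ∀ (RA' : RecA d k) (RB' : RecB k), Ic V RA' RB' ≤ Ic V RA RB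

/-- The map `|ψ⟩ ↦ |ψ⟩_{A₁} ⊗ |χ⟩_{A₂ Ā}`. -/
def appendState {d k : ℕ} (χ : Fin k × Fin k → ℂ) : Matrix (Idx d k) (Fin d) ℂ :=
  fun p j => if p.1.1 = j then χ (p.1.2, p.2) else 0

/-- The operator `I_{A₁} ⊗ |χ⟩⟨χ|_{A₂ Ā}`. -/
noncomputable def stateProj (d : ℕ) {k : ℕ} (χ : Fin k × Fin k → ℂ) :
    Matrix (Idx d k) (Idx d k) ℂ :=
  fun p q => if p.1.1 = q.1.1 then χ (p.1.2, p.2) * star (χ (q.1.2, q.2)) else 0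

/-- The unitary `e^{iεH}`. -/
noncomputable def expI {n : Type*} [Fintype n] [DecidableEq n] (H : Matrix n n ℂ) (ε : ℝ) :
    Matrix n n ℂ :=
  NormedSpace.exp ((Complex.I * (ε : ℂ)) • H)

/-- `V ε = e^{iεW} V 0` is a skewing of the code `V 0`, which is an exact erasure-correcting code
with recovery unitaries `RA₀`, `RB₀` and with a state `χ` on `A₂ Ā` of flat entanglement spectrum
and full Schmidt rank `k`. -/
structure IsSkewedCode {d k : ℕ} (V : ℝ → Matrix (Idx d k) (Fin d) ℂ)
    (W : Matrix (Idx d k) (Idx d k) ℂ) (χ : Fin k × Fin k → ℂ)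
    (RA₀ : RecA d k) (RB₀ : RecB k) : Prop where
  hermitian : W.IsHermitian
  skewed : ∀ ε, V ε = expI W ε * V 0
  flat : trRight (Matrix.vecMulVec χ (star χ)) = (1 / k : ℂ) • (1 : Matrix (Fin k) (Fin k) ℂ)
  exact_recovery : recovery RA₀ RB₀ * V 0 = appendState χ

/-- `RA ε`, `RB ε` are recovery unitaries that start at the exact ones and whose effective
perturbation `R_A(ε) R_Ā(ε) e^{iεW} R_A(0)† R_Ā(0)†` equals `1 + iε W_R + o(ε)`, that is,
`e^{iε W_R}` to leading order. -/
structure IsRecoveryFamily {d k : ℕ} (W : Matrix (Idx d k) (Idx d k) ℂ)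
    (RA₀ : RecA d k) (RB₀ : RecB k) (RA : ℝ → RecA d k) (RB : ℝ → RecB k)
    (WR : Matrix (Idx d k) (Idx d k) ℂ) : Prop where
  start_A : RA 0 = RA₀
  start_B : RB 0 = RB₀
  hermitian : WR.IsHermitian
  generator : ∀ p q, HasDerivAt
    (fun ε : ℝ => (recovery (RA ε) (RB ε) * expI W ε * (recovery RA₀ RB₀)ᴴ) p q)
    (Complex.I * WR p q) 0

/-- `J = d_χ Tr_Ā {W_R, χ}`. -/
noncomputable def opJ {d k : ℕ} (χ : Fin k × Fin k → ℂ) (WR : Matrix (Idx d k) (Idx d k) ℂ) :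
    Matrix (IdxA d k) (IdxA d k) ℂ :=
  (k : ℂ) • trRight (WR * stateProj d χ + stateProj d χ * WR)

/-- `D = i d_χ Tr_Ā [W_R, χ]`. -/
noncomputable def opD {d k : ℕ} (χ : Fin k × Fin k → ℂ) (WR : Matrix (Idx d k) (Idx d k) ℂ) :
    Matrix (IdxA d k) (IdxA d k) ℂ :=
  (Complex.I * (k : ℂ)) • trRight (WR * stateProj d χ - stateProj d χ * WR)

/-- The coefficient `c₁(W_R)`. -/
noncomputable def c₁ {d k : ℕ} (χ : Fin k × Fin k → ℂ) (WR : Matrix (Idx d k) (Idx d k) ℂ) : ℝ :=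
  (d : ℝ) / (2 * k * ((d : ℝ) ^ 2 - 1)) *
    ((opJ χ WR ^ 2).trace
      - (1 / d : ℂ) * (trLeft (opJ χ WR) ^ 2).trace
      - (1 / k : ℂ) * (trRight (opJ χ WR) ^ 2).trace
      + (1 / (d * k) : ℂ) * (opJ χ WR).trace ^ 2).re

/-- The coefficient `c₂(W_R)`. -/
noncomputable def c₂ {d k : ℕ} (χ : Fin k × Fin k → ℂ) (WR : Matrix (Idx d k) (Idx d k) ℂ) : ℝ :=
  (d : ℝ) / (2 * k * ((d : ℝ) ^ 2 - 1)) *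
    ((opD χ WR ^ 2).trace - (1 / d : ℂ) * (trLeft (opD χ WR) ^ 2).trace).re

end MixedBulk

/-! Because `χ` is flat with full Schmidt rank, every `Z` from the logical system to `A Ā` equals
`(Y ⊗ 1)|ψ⟩|χ⟩` for a unique operator `Y = reduce χ Z` on `A₁ ⊗ A₂`, and up to the factor `√k` this
correspondence is isometric. A recovery on `A` multiplies `Y` on the left. A recovery on `Ā` turns
into a unitary on `A₂` multiplying `Y` on the right, which the traced-out system cannot detect. So
the coherent information is a function `choiInfo` of `Y` alone.

For `Y` near the identity, the marginal state on `A₁` has entropy `log d + O(ε²)`, and the joint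
state with the reference has largest eigenvalue `1 - q` and entropy `-q log q + O(q)`. By
Eckart-Young applied to the realigned matrix, `d k q` is the squared Frobenius distance from `Y` to
the product operators `K ⊗ L` (`exists_spectral_defect`). If `Y = 1 + εB + o(ε)`, then to first
order the products near `1` fill out exactly the local directions, so `q ~ ε² ‖ΠB‖² / (d k)`, with
`Π` the projection off local operators (`tendsto_spectral_defect`). Hence the leading deviation from
`log d` is `2 ‖ΠB‖² / (d k) · ε² log|ε|`. Here `B = D/2 + iJ/2` with `D`, `J` Hermitian, so the two
parts are orthogonal and the coefficient is proportional to `c₁ + c₂`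
(`IsSkewedCode.Ic_asymptotics`).

Changing the recovery changes `W_R` by a local Hermitian operator, which reduces to a Hermitian
operator on `A`: this moves `J` and leaves `D` fixed (`IsSkewedCode.opD_eq_const`). The choice `O =
-J/2` removes `J`. Thus `c₂` is an unavoidable loss and `c₁` a removable one, which gives the
comparison of families. Since the optimal value depends only on `V`, its leading coefficient
identifies `c₂` independently of the description.

The delicate point is an exactly optimal family that is differentiable at `0`. Maximizers exist by
compactness but may jump by product unitaries and need not be near the identity. Near-minimality of
`q`, together with a polar decomposition of the nearest product operator, fixes this freedom and
forces the first-order term (`exists_product_gauge`). -/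

set_option linter.unusedSectionVars false

namespace MixedBulk

/-! ### Frobenius norm and entrywise asymptotics. -/

section Frobenius

open scoped Matrix.Norms.Frobenius

variable {l m n : Type*} [Fintype l] [Fintype m] [Fintype n]

theorem frobenius_sq (A : Matrix m n ℂ) : ‖A‖ ^ 2 = ∑ i, ∑ j, ‖A i j‖ ^ 2 := by
  have h : 0 ≤ ∑ i, ∑ j, ‖A i j‖ ^ (2 : ℝ) :=
    Finset.sum_nonneg fun i _ => Finset.sum_nonneg fun j _ => Real.rpow_nonneg (norm_nonneg _) _
  rw [frobenius_norm_def, ← Real.sqrt_eq_rpow, Real.sq_sqrt h]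
  simp

theorem trace_conjTranspose_mul_self (A : Matrix m n ℂ) :
    (Aᴴ * A).trace = ((‖A‖ ^ 2 : ℝ) : ℂ) := by
  rw [frobenius_sq, Finset.sum_comm]
  simp only [trace, diag, mul_apply, conjTranspose_apply]
  push_cast
  refine Finset.sum_congr rfl fun j _ => Finset.sum_congr rfl fun i _ => ?_
  exact Complex.conj_mul' _

theorem frobenius_sq_eq_trace (A : Matrix m n ℂ) : ‖A‖ ^ 2 = ((Aᴴ * A).trace).re := by
  rw [trace_conjTranspose_mul_self, Complex.ofReal_re]

theorem norm_entry_le (A : Matrix m n ℂ) (i : m) (j : n) : ‖A i j‖ ≤ ‖A‖ := by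
  refine le_of_sq_le_sq ?_ (norm_nonneg _)
  rw [frobenius_sq]
  calc ‖A i j‖ ^ 2 ≤ ∑ j, ‖A i j‖ ^ 2 :=
        Finset.single_le_sum (f := fun j => ‖A i j‖ ^ 2) (fun _ _ => sq_nonneg _)
          (Finset.mem_univ j)
    _ ≤ _ := Finset.single_le_sum (f := fun i => ∑ j, ‖A i j‖ ^ 2)
          (fun _ _ => Finset.sum_nonneg fun _ _ => sq_nonneg _) (Finset.mem_univ i)

theorem norm_le_sum_entries (A : Matrix m n ℂ) : ‖A‖ ≤ ∑ i, ∑ j, ‖A i j‖ := by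
  classical
  have h : A = ∑ i, ∑ j, Matrix.single i j (A i j) := matrix_eq_sum_single A
  have hs : ∀ i j, ‖Matrix.single i j (A i j)‖ ≤ ‖A i j‖ := by
    intro i j
    refine le_of_sq_le_sq ?_ (norm_nonneg _)
    rw [frobenius_sq, Finset.sum_eq_single i, Finset.sum_eq_single j]
    · simp
    · intro b _ hb; simp [Matrix.single, hb.symm]
    · simp
    · intro b _ hb; simp [Matrix.single, hb.symm]
    · simp
  calc ‖A‖ = ‖∑ i, ∑ j, Matrix.single i j (A i j)‖ := by rw [← h]
    _ ≤ _ := (norm_sum_le _ _).trans (Finset.sum_le_sum fun i _ =>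
      (norm_sum_le _ _).trans (Finset.sum_le_sum fun j _ => hs i j))

theorem isBigO_matrix {f : ℝ → Matrix m n ℂ} {g : ℝ → ℝ} {L : Filter ℝ} :
    f =O[L] g ↔ ∀ i j, (fun x => f x i j) =O[L] g := by
  refine ⟨fun h i j => (IsBigO.of_bound 1 (Eventually.of_forall fun x => ?_)).trans h, fun h => ?_⟩
  · simpa using norm_entry_le (f x) i j
  · refine IsBigO.trans (g := fun x => ∑ i, ∑ j, ‖f x i j‖) ?_ ?_
    · refine IsBigO.of_bound 1 (Eventually.of_forall fun x => ?_)
      rw [one_mul]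
      exact (norm_le_sum_entries _).trans (le_abs_self _)
    · exact IsBigO.fun_sum fun i _ => IsBigO.fun_sum fun j _ => (h i j).norm_left

theorem isLittleO_matrix {f : ℝ → Matrix m n ℂ} {g : ℝ → ℝ} {L : Filter ℝ} :
    f =o[L] g ↔ ∀ i j, (fun x => f x i j) =o[L] g := by
  refine ⟨fun h i j => (IsBigO.of_bound 1 (Eventually.of_forall fun x => ?_)).trans_isLittleO h,
    fun h => ?_⟩
  · simpa using norm_entry_le (f x) i j
  · refine IsBigO.trans_isLittleO (g := fun x => ∑ i, ∑ j, ‖f x i j‖) ?_ ?_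
    · refine IsBigO.of_bound 1 (Eventually.of_forall fun x => ?_)
      rw [one_mul]
      exact (norm_le_sum_entries _).trans (le_abs_self _)
    · exact IsLittleO.fun_sum fun i _ => IsLittleO.fun_sum fun j _ => (h i j).norm_left

theorem norm_sq_add_of_trace_eq_zero {A B : Matrix m n ℂ} (h : (Aᴴ * B).trace.re = 0) :
    ‖A + B‖ ^ 2 = ‖A‖ ^ 2 + ‖B‖ ^ 2 := by
  have h' : (Bᴴ * A).trace.re = 0 := by
    rw [← h, ← conjTranspose_conjTranspose A, ← conjTranspose_mul, trace_conjTranspose,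
      conjTranspose_conjTranspose]
    simp
  simp only [frobenius_sq_eq_trace, conjTranspose_add, Matrix.add_mul, Matrix.mul_add, trace_add,
    Complex.add_re, h, h']
  ring

/-- `Tr(HS)` is purely imaginary. This orthogonality is what separates the `c₁` and `c₂`
contributions. -/
theorem norm_sq_hermitian_add {H S : Matrix m m ℂ} (hH : Hᴴ = H) (hS : Sᴴ = -S) :
    ‖H + S‖ ^ 2 = ‖H‖ ^ 2 + ‖S‖ ^ 2 := by
  apply norm_sq_add_of_trace_eq_zero
  have h : (Hᴴ * S).trace = star (-(Hᴴ * S).trace) := by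
    rw [star_neg, ← trace_conjTranspose, conjTranspose_mul, hS, conjTranspose_conjTranspose,
      Matrix.neg_mul, trace_neg, neg_neg, hH, trace_mul_comm]
  have := congrArg Complex.re h
  simp at this
  linarith

variable [DecidableEq m] [DecidableEq n]

theorem norm_unitary_mul (U : unitaryGroup m ℂ) (A : Matrix m n ℂ) :
    ‖(U : Matrix m m ℂ) * A‖ = ‖A‖ := by
  have h : ‖(U : Matrix m m ℂ) * A‖ ^ 2 = ‖A‖ ^ 2 := by
    rw [frobenius_sq_eq_trace, frobenius_sq_eq_trace, conjTranspose_mul, Matrix.mul_assoc,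
      ← Matrix.mul_assoc _ (U : Matrix m m ℂ) A, ← star_eq_conjTranspose (U : Matrix m m ℂ),
      UnitaryGroup.star_mul_self, Matrix.one_mul]
  exact (sq_eq_sq₀ (norm_nonneg _) (norm_nonneg _)).1 h

theorem norm_kronecker (A : Matrix m m ℂ) (B : Matrix n n ℂ) : ‖A ⊗ₖ B‖ = ‖A‖ * ‖B‖ := by
  have h : ‖A ⊗ₖ B‖ ^ 2 = (‖A‖ * ‖B‖) ^ 2 := by
    rw [mul_pow, frobenius_sq_eq_trace, conjTranspose_kronecker, ← mul_kronecker_mul,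
      trace_kronecker, trace_conjTranspose_mul_self, trace_conjTranspose_mul_self,
      ← Complex.ofReal_mul, Complex.ofReal_re]
  exact (sq_eq_sq₀ (norm_nonneg _) (by positivity)).1 h

end Frobenius

/-! ### Partial traces and the projection off local operators. -/

section PartialTrace

variable {m n : Type*} [Fintype m] [Fintype n]

theorem trRight_add (A B : Matrix (m × n) (m × n) ℂ) :
    trRight (A + B) = trRight A + trRight B := by
  ext; simp [trRight, Finset.sum_add_distrib]

theorem trLeft_add (A B : Matrix (m × n) (m × n) ℂ) :
    trLeft (A + B) = trLeft A + trLeft B := by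
  ext; simp [trLeft, Finset.sum_add_distrib]

theorem trRight_smul (c : ℂ) (A : Matrix (m × n) (m × n) ℂ) :
    trRight (c • A) = c • trRight A := by
  ext; simp [trRight, Finset.mul_sum]

theorem trLeft_smul (c : ℂ) (A : Matrix (m × n) (m × n) ℂ) :
    trLeft (c • A) = c • trLeft A := by
  ext; simp [trLeft, Finset.mul_sum]

theorem trRight_conjTranspose (A : Matrix (m × n) (m × n) ℂ) : trRight Aᴴ = (trRight A)ᴴ := by
  ext; simp [trRight]

theorem trLeft_conjTranspose (A : Matrix (m × n) (m × n) ℂ) : trLeft Aᴴ = (trLeft A)ᴴ := by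
  ext; simp [trLeft]

theorem trRight_kronecker (A : Matrix m m ℂ) (B : Matrix n n ℂ) :
    trRight (A ⊗ₖ B) = B.trace • A := by
  ext; simp [trRight, trace, ← Finset.mul_sum, mul_comm]

theorem trLeft_kronecker (A : Matrix m m ℂ) (B : Matrix n n ℂ) :
    trLeft (A ⊗ₖ B) = A.trace • B := by
  ext; simp [trLeft, trace, Finset.sum_mul]

theorem trace_trRight (A : Matrix (m × n) (m × n) ℂ) : (trRight A).trace = A.trace := by
  simp [trRight, trace, Fintype.sum_prod_type]

theorem trace_trLeft (A : Matrix (m × n) (m × n) ℂ) : (trLeft A).trace = A.trace := by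
  simp [trLeft, trace, Fintype.sum_prod_type_right]

theorem trace_mul_one_kronecker [DecidableEq m] (A : Matrix (m × n) (m × n) ℂ)
    (B : Matrix n n ℂ) : (A * ((1 : Matrix m m ℂ) ⊗ₖ B)).trace = (trLeft A * B).trace := by
  simp only [trace, diag, mul_apply, Fintype.sum_prod_type, kroneckerMap_apply, one_apply, trLeft,
    Finset.sum_mul, ite_mul, mul_ite, zero_mul, mul_zero, one_mul]
  rw [Finset.sum_comm]
  refine Finset.sum_congr rfl fun x _ => ?_
  rw [Finset.sum_comm]
  simp only [Finset.sum_comm (s := (Finset.univ : Finset n)) (t := (Finset.univ : Finset m))]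
  simp [Finset.sum_ite_eq]

theorem trace_mul_kronecker_one [DecidableEq n] (A : Matrix (m × n) (m × n) ℂ)
    (B : Matrix m m ℂ) : (A * (B ⊗ₖ (1 : Matrix n n ℂ))).trace = (trRight A * B).trace := by
  simp only [trace, diag, mul_apply, Fintype.sum_prod_type, kroneckerMap_apply, one_apply, trRight,
    Finset.sum_mul, mul_ite, mul_zero, mul_one]
  refine Finset.sum_congr rfl fun a _ => ?_
  rw [Finset.sum_comm]
  simp

variable [DecidableEq m] [DecidableEq n]

/-- `Tr X • X - Tr₂ X ⊗ Tr₁ X`, which vanishes on product operators. -/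
noncomputable def prodDefect (X : Matrix (m × n) (m × n) ℂ) : Matrix (m × n) (m × n) ℂ :=
  X.trace • X - trRight X ⊗ₖ trLeft X

theorem prodDefect_kronecker (K : Matrix m m ℂ) (L : Matrix n n ℂ) :
    prodDefect (K ⊗ₖ L) = 0 := by
  rw [prodDefect, trace_kronecker, trRight_kronecker, trLeft_kronecker, smul_kronecker,
    kronecker_smul, smul_smul, mul_comm, sub_self]

/-- The orthogonal projection onto the operators both of whose partial traces vanish. -/
noncomputable def tracelessProj (m n : Type*) [Fintype m] [Fintype n] [DecidableEq m]
    [DecidableEq n] : Matrix (m × n) (m × n) ℂ →ₗ[ℂ] Matrix (m × n) (m × n) ℂ where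
  toFun A := A - (1 / Fintype.card m : ℂ) • ((1 : Matrix m m ℂ) ⊗ₖ trLeft A)
    - (1 / Fintype.card n : ℂ) • (trRight A ⊗ₖ (1 : Matrix n n ℂ))
    + (A.trace / (Fintype.card m * Fintype.card n)) • 1
  map_add' A B := by
    rw [trLeft_add, trRight_add, kronecker_add, add_kronecker, trace_add, add_div, add_smul,
      smul_add, smul_add]
    abel
  map_smul' c A := by
    rw [trLeft_smul, trRight_smul, kronecker_smul, smul_kronecker, trace_smul, smul_eq_mul,
      mul_div_assoc, mul_smul, RingHom.id_apply]
    module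

theorem tracelessProj_apply (A : Matrix (m × n) (m × n) ℂ) :
    tracelessProj m n A = A - (1 / Fintype.card m : ℂ) • ((1 : Matrix m m ℂ) ⊗ₖ trLeft A)
    - (1 / Fintype.card n : ℂ) • (trRight A ⊗ₖ (1 : Matrix n n ℂ))
    + (A.trace / (Fintype.card m * Fintype.card n)) • 1 := rfl

theorem tracelessProj_conjTranspose (A : Matrix (m × n) (m × n) ℂ) :
    tracelessProj m n Aᴴ = (tracelessProj m n A)ᴴ := by
  simp only [tracelessProj_apply, trLeft_conjTranspose, trRight_conjTranspose, trace_conjTranspose,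
    conjTranspose_add, conjTranspose_sub, conjTranspose_smul, conjTranspose_kronecker,
    conjTranspose_one]
  simp

variable [Nonempty m] [Nonempty n]

theorem trLeft_tracelessProj (A : Matrix (m × n) (m × n) ℂ) :
    trLeft (tracelessProj m n A) = 0 := by
  have hm : (Fintype.card m : ℂ) ≠ 0 := by simp
  have hn : (Fintype.card n : ℂ) ≠ 0 := by simp
  rw [tracelessProj_apply, sub_eq_add_neg, sub_eq_add_neg, ← neg_smul, ← neg_smul,
    ← one_kronecker_one, trLeft_add, trLeft_add, trLeft_add, trLeft_smul, trLeft_smul, trLeft_smul,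
    trLeft_kronecker, trLeft_kronecker, trLeft_kronecker, trace_trRight, trace_one, smul_smul,
    smul_smul, smul_smul]
  ext i j
  simp
  field_simp
  ring

theorem trRight_tracelessProj (A : Matrix (m × n) (m × n) ℂ) :
    trRight (tracelessProj m n A) = 0 := by
  have hm : (Fintype.card m : ℂ) ≠ 0 := by simp
  have hn : (Fintype.card n : ℂ) ≠ 0 := by simp
  rw [tracelessProj_apply, sub_eq_add_neg, sub_eq_add_neg, ← neg_smul, ← neg_smul,
    ← one_kronecker_one, trRight_add, trRight_add, trRight_add, trRight_smul, trRight_smul,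
    trRight_smul, trRight_kronecker, trRight_kronecker, trRight_kronecker, trace_trLeft, trace_one,
    smul_smul, smul_smul, smul_smul]
  ext i j
  simp
  field_simp
  ring

/-- `prodDefect` is quadratic, so at the identity it splits into a linear and a quadratic part. The
linear part is a multiple of `tracelessProj`, which is how this projection measures the first-order
failure to be a product. -/
theorem prodDefect_one_add (X : Matrix (m × n) (m × n) ℂ) :
    prodDefect (1 + X) =
      (Fintype.card m * Fintype.card n : ℂ) • tracelessProj m n X + prodDefect X := by
  have hm : (Fintype.card m : ℂ) ≠ 0 := by simp
  have hn : (Fintype.card n : ℂ) ≠ 0 := by simp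
  rw [prodDefect, prodDefect, tracelessProj_apply, ← one_kronecker_one, trRight_add, trLeft_add,
    trRight_kronecker, trLeft_kronecker, trace_add, trace_kronecker, trace_one, trace_one]
  ext ⟨i, x⟩ ⟨j, y⟩
  have h1 : (1 : Matrix (m × n) (m × n) ℂ) (i, x) (j, y) =
      (1 : Matrix m m ℂ) i j * (1 : Matrix n n ℂ) x y := by
    rw [← one_kronecker_one]; rfl
  simp [h1]
  field_simp
  ring

theorem trace_tracelessProj_mul_one_kronecker (A : Matrix (m × n) (m × n) ℂ) (B : Matrix n n ℂ) :
    ((tracelessProj m n A)ᴴ * ((1 : Matrix m m ℂ) ⊗ₖ B)).trace = 0 := by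
  rw [trace_mul_one_kronecker, trLeft_conjTranspose, trLeft_tracelessProj]
  simp

theorem trace_tracelessProj_mul_kronecker_one (A : Matrix (m × n) (m × n) ℂ) (B : Matrix m m ℂ) :
    ((tracelessProj m n A)ᴴ * (B ⊗ₖ (1 : Matrix n n ℂ))).trace = 0 := by
  rw [trace_mul_kronecker_one, trRight_conjTranspose, trRight_tracelessProj]
  simp

theorem trace_tracelessProj_mul_sub (A : Matrix (m × n) (m × n) ℂ) :
    ((tracelessProj m n A)ᴴ * (A - tracelessProj m n A)).trace = 0 := by
  have h : A - tracelessProj m n A = (1 / Fintype.card m : ℂ) • ((1 : Matrix m m ℂ) ⊗ₖ trLeft A)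
      + (1 / Fintype.card n : ℂ) • (trRight A ⊗ₖ (1 : Matrix n n ℂ))
      - (A.trace / (Fintype.card m * Fintype.card n)) • ((1 : Matrix m m ℂ) ⊗ₖ (1 : Matrix n n ℂ)) := by
    rw [tracelessProj_apply, one_kronecker_one]
    abel
  rw [h, Matrix.mul_sub, Matrix.mul_add, Matrix.mul_smul, Matrix.mul_smul, Matrix.mul_smul,
    trace_sub, trace_add, trace_smul, trace_smul, trace_smul, trace_tracelessProj_mul_one_kronecker,
    trace_tracelessProj_mul_one_kronecker, trace_tracelessProj_mul_kronecker_one]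
  simp

open scoped Matrix.Norms.Frobenius in
theorem norm_tracelessProj_le (A : Matrix (m × n) (m × n) ℂ) : ‖tracelessProj m n A‖ ≤ ‖A‖ := by
  refine le_of_sq_le_sq ?_ (norm_nonneg _)
  have := norm_sq_add_of_trace_eq_zero (congrArg Complex.re (trace_tracelessProj_mul_sub A))
  rw [add_sub_cancel] at this
  rw [this]
  linarith [sq_nonneg ‖A - tracelessProj m n A‖]

-- For Hermitian `A` the right side has the shape of the bracket defining `c₁`.
open scoped Matrix.Norms.Frobenius in
theorem norm_tracelessProj_sq (A : Matrix (m × n) (m × n) ℂ) :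
    ‖tracelessProj m n A‖ ^ 2 = ((Aᴴ * A).trace
      - (1 / Fintype.card m : ℂ) * ((trLeft A)ᴴ * trLeft A).trace
      - (1 / Fintype.card n : ℂ) * ((trRight A)ᴴ * trRight A).trace
      + (1 / (Fintype.card m * Fintype.card n) : ℂ) * (star A.trace * A.trace)).re := by
  have h := trace_tracelessProj_mul_sub A
  rw [Matrix.mul_sub, trace_sub, sub_eq_zero] at h
  rw [frobenius_sq_eq_trace, ← h]
  have h2 : ((tracelessProj m n A)ᴴ * A).trace.re = (Aᴴ * tracelessProj m n A).trace.re := by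
    rw [← conjTranspose_conjTranspose ((tracelessProj m n A)ᴴ * A), trace_conjTranspose,
      conjTranspose_mul, conjTranspose_conjTranspose]
    simp
  rw [h2, tracelessProj_apply, Matrix.mul_add, Matrix.mul_sub, Matrix.mul_sub, Matrix.mul_smul,
    Matrix.mul_smul, Matrix.mul_smul, Matrix.mul_one, trace_add, trace_sub, trace_sub, trace_smul,
    trace_smul, trace_smul, trace_mul_one_kronecker, trace_mul_kronecker_one,
    trLeft_conjTranspose, trRight_conjTranspose, trace_conjTranspose]
  simp only [smul_eq_mul]
  congr 2
  ring

end PartialTrace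

end MixedBulk

namespace MixedBulk

open scoped ComplexOrder

/-! ### Entropy bounds in terms of eigenvalues. -/

section Entropy

variable {n : Type*} [Fintype n] [DecidableEq n]

theorem trace_cfc_eq_sum {ρ : Matrix n n ℂ} (hρ : ρ.IsHermitian) (f : ℝ → ℝ) :
    (cfc f ρ).trace = ∑ i, ((f (hρ.eigenvalues i) : ℝ) : ℂ) := by
  rw [hρ.cfc_eq, IsHermitian.cfc, Unitary.conjStarAlgAut_apply, trace_mul_cycle,
    Unitary.coe_star_mul_self, one_mul, trace_diagonal]
  rfl

theorem entropy_eq_sum {ρ : Matrix n n ℂ} (hρ : ρ.IsHermitian) :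
    entropy ρ = ∑ i, Real.negMulLog (hρ.eigenvalues i) := by
  rw [entropy, trace_cfc_eq_sum hρ, ← Complex.ofReal_sum, Complex.ofReal_re]

theorem sum_eigenvalues_sq {ρ : Matrix n n ℂ} (hρ : ρ.IsHermitian) :
    (ρ * ρ).trace = ((∑ i, hρ.eigenvalues i ^ 2 : ℝ) : ℂ) := by
  have h := trace_cfc_eq_sum hρ (fun x => x ^ 2)
  have h2 : cfc (fun x : ℝ => x ^ 2) ρ = ρ ^ 2 := cfc_pow_id (R := ℝ) ρ 2 hρ
  rw [h2, pow_two] at h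
  rw [h]
  push_cast
  rfl

theorem sum_eigenvalues_eq_one {ρ : Matrix n n ℂ} (hρ : ρ.IsHermitian) (h1 : ρ.trace = 1) :
    ∑ i, hρ.eigenvalues i = 1 := by
  have h := hρ.trace_eq_sum_eigenvalues
  rw [h1] at h
  rw [← Complex.ofReal_inj, Complex.ofReal_sum, Complex.ofReal_one]
  exact h.symm

theorem entropy_unitary_conj (U : unitaryGroup n ℂ) {ρ : Matrix n n ℂ} (hρ : ρ.IsHermitian) :
    entropy ((U : Matrix n n ℂ) * ρ * (U : Matrix n n ℂ)ᴴ) = entropy ρ := by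
  have h' : ((U : Matrix n n ℂ) * ρ * (U : Matrix n n ℂ)ᴴ).IsHermitian :=
    isHermitian_mul_mul_conjTranspose _ hρ
  rw [entropy_eq_sum h', entropy_eq_sum hρ, (h'.eigenvalues_eq_eigenvalues_iff hρ).2]
  rw [charpoly_mul_comm, ← Matrix.mul_assoc, ← star_eq_conjTranspose,
    UnitaryGroup.star_mul_self, Matrix.one_mul]

/-- Sum `negMulLog (n p) ≤ 1 - n p` over the eigenvalues `p`, with `n` the dimension. -/
theorem entropy_le_log_card [Nonempty n] {ρ : Matrix n n ℂ} (hρ : ρ.PosSemidef)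
    (h1 : ρ.trace = 1) : entropy ρ ≤ Real.log (Fintype.card n) := by
  have hc : (0 : ℝ) < Fintype.card n := by exact_mod_cast Fintype.card_pos
  have hs := sum_eigenvalues_eq_one hρ.1 h1
  rw [entropy_eq_sum hρ.1]
  have key : ∀ i, (Fintype.card n : ℝ) * Real.negMulLog (hρ.1.eigenvalues i) ≤
      1 - Fintype.card n * hρ.1.eigenvalues i
        + Fintype.card n * Real.log (Fintype.card n) * hρ.1.eigenvalues i := by
    intro i
    have h := Real.negMulLog_le_one_sub_self (mul_nonneg hc.le (hρ.eigenvalues_nonneg i))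
    rw [Real.negMulLog_mul] at h
    have h2 : Real.negMulLog (Fintype.card n : ℝ) =
      -((Fintype.card n : ℝ) * Real.log (Fintype.card n)) := by rw [Real.negMulLog]; ring
    rw [h2] at h
    linarith
  have h := Finset.sum_le_sum fun i (_ : i ∈ Finset.univ) => key i
  rw [← Finset.mul_sum, Finset.sum_add_distrib, Finset.sum_sub_distrib, ← Finset.mul_sum,
    ← Finset.mul_sum, hs] at h
  simp only [Finset.sum_const, Finset.card_univ, nsmul_eq_mul] at h
  nlinarith

/-- From `log (n p) ≤ n p - 1`. The loss is quadratic in the distance to the maximally mixed state,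
so an `O(ε)` deviation of the marginal costs only `O(ε²)`. -/
theorem log_card_le_entropy [Nonempty n] {ρ : Matrix n n ℂ} (hρ : ρ.PosSemidef)
    (h1 : ρ.trace = 1) :
    Real.log (Fintype.card n) + 1 - Fintype.card n * ((ρ * ρ).trace).re ≤ entropy ρ := by
  have hc : (0 : ℝ) < Fintype.card n := by exact_mod_cast Fintype.card_pos
  have hs := sum_eigenvalues_eq_one hρ.1 h1
  rw [entropy_eq_sum hρ.1, sum_eigenvalues_sq hρ.1, Complex.ofReal_re]
  have key : ∀ i, (Real.log (Fintype.card n) + 1) * hρ.1.eigenvalues i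
      - Fintype.card n * hρ.1.eigenvalues i ^ 2 ≤ Real.negMulLog (hρ.1.eigenvalues i) := by
    intro i
    rcases (hρ.eigenvalues_nonneg i).eq_or_lt with h0 | h0
    · rw [← h0]; simp
    · have h := Real.log_le_sub_one_of_pos (mul_pos hc h0)
      rw [Real.log_mul hc.ne' h0.ne'] at h
      rw [Real.negMulLog]
      nlinarith
  have h := Finset.sum_le_sum fun i (_ : i ∈ Finset.univ) => key i
  rw [Finset.sum_sub_distrib, ← Finset.mul_sum, ← Finset.mul_sum, hs] at h
  linarith

/-- With `q = 1 - p i₀`, every other weight is at most `q`, so `-log p i ≥ -log q`, which gives the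
lower bound. The upper bound writes `p i = q · (p i / q)` and bounds `negMulLog (p i / q)` by `1`.
Together the entropy is `negMulLog q + O(q)`. The bound away from `1` matters because `negMulLog`
also vanishes at `1`. -/
theorem sum_negMulLog_bounds {p : n → ℝ} (hp : ∀ i, 0 ≤ p i) (hs : ∑ i, p i = 1) (i₀ : n)
    (hmax : ∀ i, p i ≤ p i₀) :
    0 ≤ 1 - p i₀ ∧ 1 - p i₀ ≤ 1 - 1 / Fintype.card n ∧
    Real.negMulLog (1 - p i₀) ≤ ∑ i, Real.negMulLog (p i) ∧
    ∑ i, Real.negMulLog (p i) ≤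
      Real.negMulLog (1 - p i₀) + (1 + Fintype.card n) * (1 - p i₀) := by
  have : Nonempty n := ⟨i₀⟩
  have hc : (0 : ℝ) < Fintype.card n := by exact_mod_cast Fintype.card_pos
  have hle : ∀ i, p i ≤ 1 := fun i => hs ▸ Finset.single_le_sum (fun j _ => hp j) (Finset.mem_univ i)
  have hrest : ∑ i ∈ Finset.univ.erase i₀, p i = 1 - p i₀ := by
    rw [← hs, ← Finset.add_sum_erase _ _ (Finset.mem_univ i₀)]; ring
  have hsplit : ∑ i, Real.negMulLog (p i) =
      Real.negMulLog (p i₀) + ∑ i ∈ Finset.univ.erase i₀, Real.negMulLog (p i) :=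
    (Finset.add_sum_erase _ _ (Finset.mem_univ i₀)).symm
  set q := 1 - p i₀ with hq
  have hq0 : 0 ≤ q := sub_nonneg.2 (hle i₀)
  refine ⟨hq0, ?_, ?_, ?_⟩
  · have h := Finset.sum_le_sum fun i (_ : i ∈ Finset.univ) => hmax i
    rw [hs] at h
    simp only [Finset.sum_const, Finset.card_univ, nsmul_eq_mul] at h
    have : 1 / (Fintype.card n : ℝ) ≤ p i₀ := by rw [div_le_iff₀ hc]; linarith
    linarith
  · have h0 : 0 ≤ Real.negMulLog (p i₀) := Real.negMulLog_nonneg (hp _) (hle _)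
    have key : ∀ i ∈ Finset.univ.erase i₀, p i * (-Real.log q) ≤ Real.negMulLog (p i) := by
      intro i hi
      rcases (hp i).eq_or_lt with hi0 | hi0
      · rw [← hi0]; simp
      · have hiq : p i ≤ q := hrest ▸ Finset.single_le_sum (fun j _ => hp j) hi
        have := Real.log_le_log hi0 hiq
        rw [Real.negMulLog]
        nlinarith
    have h := Finset.sum_le_sum key
    rw [← Finset.sum_mul, hrest] at h
    rw [hsplit]
    have : Real.negMulLog q = q * -Real.log q := by rw [Real.negMulLog]; ring
    linarith
  · have h0 : Real.negMulLog (p i₀) ≤ q := Real.negMulLog_le_one_sub_self (hp i₀)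
    suffices ∑ i ∈ Finset.univ.erase i₀, Real.negMulLog (p i) ≤
        Real.negMulLog q + Fintype.card n * q by rw [hsplit]; linarith
    have key : ∀ i ∈ Finset.univ.erase i₀, Real.negMulLog (p i) ≤
        p i * (-Real.log q) + q := by
      intro i hi
      have hiq : p i ≤ q := hrest ▸ Finset.single_le_sum (fun j _ => hp j) hi
      rcases hq0.eq_or_lt with h | h
      · have : p i = 0 := le_antisymm (hiq.trans h.symm.le) (hp i)
        simp [this, ← h]
      · have h2 := Real.negMulLog_le_one_sub_self (div_nonneg (hp i) h.le)
        have h3 := Real.negMulLog_mul q (p i / q)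
        rw [mul_div_cancel₀ _ h.ne'] at h3
        have h4 : p i / q * Real.negMulLog q = p i * -Real.log q := by
          rw [Real.negMulLog]; field_simp
        rw [h3, h4]
        have : 0 ≤ p i / q := div_nonneg (hp i) h.le
        nlinarith
    refine (Finset.sum_le_sum key).trans ?_
    rw [Finset.sum_add_distrib, ← Finset.sum_mul, hrest, Finset.sum_const, nsmul_eq_mul]
    have h5 : ((Finset.univ.erase i₀).card : ℝ) ≤ Fintype.card n := by
      exact_mod_cast Finset.card_le_univ _
    have : Real.negMulLog q = q * -Real.log q := by rw [Real.negMulLog]; ring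
    nlinarith

theorem posSemidef_smul_one_sub {ρ : Matrix n n ℂ} (hρ : ρ.IsHermitian) {c : ℝ}
    (hc : ∀ i, hρ.eigenvalues i ≤ c) : ((c : ℂ) • (1 : Matrix n n ℂ) - ρ).PosSemidef := by
  have h := hρ.spectral_theorem
  set U := hρ.eigenvectorUnitary
  have hU : (U : Matrix n n ℂ) * (U : Matrix n n ℂ)ᴴ = 1 := Unitary.coe_mul_star_self U
  have h2 : (c : ℂ) • (1 : Matrix n n ℂ) - ρ = (U : Matrix n n ℂ) *
      diagonal (fun i => (c : ℂ) - hρ.eigenvalues i) * (U : Matrix n n ℂ)ᴴ := by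
    conv_lhs => rw [h]
    rw [Unitary.conjStarAlgAut_apply]
    have : diagonal (fun i => (c : ℂ) - hρ.eigenvalues i) = (c : ℂ) • (1 : Matrix n n ℂ) -
        diagonal (RCLike.ofReal ∘ hρ.eigenvalues) := by
      rw [smul_one_eq_diagonal, diagonal_sub]; rfl
    rw [this, Matrix.mul_sub, Matrix.sub_mul, Matrix.mul_smul, Matrix.smul_mul, Matrix.mul_one, hU]
    rfl
  rw [h2]
  refine PosSemidef.mul_mul_conjTranspose_same (posSemidef_diagonal_iff.2 fun i => ?_) _
  rw [← Complex.ofReal_sub]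
  exact_mod_cast sub_nonneg.2 (hc i)

end Entropy

/-! ### Realignment and the distance to product operators. -/

section Realign

variable {m n : Type*} [Fintype m] [Fintype n]

/-- Reshuffling of an operator on `m ⊗ n` so that product operators become rank-one matrices. -/
def realign (Y : Matrix (m × n) (m × n) ℂ) : Matrix (m × m) (n × n) ℂ :=
  fun p q => Y (p.1, q.1) (p.2, q.2)

/-- The state of the first factor and a reference, when `Y` acts on a maximally entangled input. -/
noncomputable def choiState (Y : Matrix (m × n) (m × n) ℂ) : Matrix (m × m) (m × m) ℂ :=
  (1 / (Fintype.card m * Fintype.card n) : ℂ) • (realign Y * (realign Y)ᴴ)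

theorem choiState_posSemidef (Y : Matrix (m × n) (m × n) ℂ) : (choiState Y).PosSemidef := by
  have h : (0 : ℂ) ≤ 1 / (Fintype.card m * Fintype.card n) := by
    have : (0 : ℝ) ≤ 1 / (Fintype.card m * Fintype.card n) := by positivity
    have h := Complex.zero_le_real.2 this
    push_cast at h
    exact h
  exact (posSemidef_self_mul_conjTranspose _).smul h

theorem trRight_posSemidef {ρ : Matrix (m × n) (m × n) ℂ} (h : ρ.PosSemidef) :
    (trRight ρ).PosSemidef := by
  have : trRight ρ = ∑ x, ρ.submatrix (fun a => (a, x)) (fun a => (a, x)) := by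
    ext a b; simp [trRight, Matrix.sum_apply]
  rw [this]
  exact posSemidef_sum _ fun x _ => h.submatrix _

open scoped Matrix.Norms.Frobenius

theorem norm_realign (Y : Matrix (m × n) (m × n) ℂ) : ‖realign Y‖ = ‖Y‖ := by
  refine (sq_eq_sq₀ (norm_nonneg _) (norm_nonneg _)).1 ?_
  simp only [frobenius_sq, Fintype.sum_prod_type, realign]
  refine Finset.sum_congr rfl fun a _ => ?_
  rw [Finset.sum_comm]

variable [Nonempty m] [Nonempty n]

theorem trace_choiState (Y : Matrix (m × n) (m × n) ℂ)
    (hY : ‖Y‖ ^ 2 = Fintype.card m * Fintype.card n) : (choiState Y).trace = 1 := by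
  rw [choiState, trace_smul, trace_mul_comm, trace_conjTranspose_mul_self, norm_realign, hY]
  have hm : (Fintype.card m : ℂ) ≠ 0 := by simp
  have hn : (Fintype.card n : ℂ) ≠ 0 := by simp
  simp
  field_simp

/-- The distance of a matrix to the product of a column and a row. -/
theorem norm_sub_column_mul_row_sq {p q : Type*} [Fintype p] [Fintype q] (R : Matrix p q ℂ)
    (v : Matrix p Unit ℂ) (w : Matrix Unit q ℂ) :
    ‖R - v * w‖ ^ 2 = ‖R‖ ^ 2 - 2 * ((vᴴ * R * wᴴ).trace).re + ‖v‖ ^ 2 * ‖w‖ ^ 2 := by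
  have hv : vᴴ * v = ((‖v‖ ^ 2 : ℝ) : ℂ) • (1 : Matrix Unit Unit ℂ) := by
    rw [← trace_conjTranspose_mul_self]
    ext; simp [trace]
  have h1 : ((v * w)ᴴ * (v * w)).trace = ((‖v‖ ^ 2 * ‖w‖ ^ 2 : ℝ) : ℂ) := by
    rw [conjTranspose_mul, Matrix.mul_assoc, ← Matrix.mul_assoc vᴴ, hv, Matrix.smul_mul,
      Matrix.one_mul, Matrix.mul_smul, trace_smul, trace_conjTranspose_mul_self]
    simp
  have h2 : ((v * w)ᴴ * R).trace = (vᴴ * R * wᴴ).trace := by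
    rw [conjTranspose_mul, Matrix.mul_assoc, trace_mul_comm]
  have h3 : (Rᴴ * (v * w)).trace.re = (vᴴ * R * wᴴ).trace.re := by
    rw [← h2, ← conjTranspose_conjTranspose (Rᴴ * (v * w)), trace_conjTranspose,
      conjTranspose_mul, conjTranspose_conjTranspose]
    simp
  rw [frobenius_sq_eq_trace (R - v * w), conjTranspose_sub, Matrix.sub_mul, Matrix.mul_sub,
    Matrix.mul_sub, trace_sub, trace_sub, trace_sub, h1, h2, Complex.sub_re, Complex.sub_re,
    Complex.sub_re, h3, ← frobenius_sq_eq_trace, Complex.ofReal_re]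
  ring

variable [DecidableEq m] [DecidableEq n]

/-- The largest eigenvalue `1 - q` of `choiState Y` controls its entropy and measures the distance
of `Y` to product operators. -/
theorem exists_spectral_defect (Y : Matrix (m × n) (m × n) ℂ)
    (hY : ‖Y‖ ^ 2 = Fintype.card m * Fintype.card n) :
    ∃ q : ℝ, 0 ≤ q ∧ q ≤ 1 - 1 / Fintype.card (m × m) ∧
      Real.negMulLog q ≤ entropy (choiState Y) ∧
      entropy (choiState Y) ≤ Real.negMulLog q + (1 + Fintype.card (m × m)) * q ∧
      (∃ (K : Matrix m m ℂ) (L : Matrix n n ℂ),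
        ‖Y - K ⊗ₖ L‖ ^ 2 = Fintype.card m * Fintype.card n * q) ∧
      ∀ (K : Matrix m m ℂ) (L : Matrix n n ℂ),
        Fintype.card m * Fintype.card n * q ≤ ‖Y - K ⊗ₖ L‖ ^ 2 := by
  have hρ := choiState_posSemidef Y
  have hs := sum_eigenvalues_eq_one hρ.1 (trace_choiState Y hY)
  obtain ⟨i₀, -, hmax⟩ := Finset.exists_max_image (Finset.univ : Finset (m × m))
    hρ.1.eigenvalues Finset.univ_nonempty
  obtain ⟨h1, h2, h3, h4⟩ := sum_negMulLog_bounds hρ.eigenvalues_nonneg hs i₀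
    fun i => hmax i (Finset.mem_univ i)
  rw [← entropy_eq_sum hρ.1] at h3 h4
  set lam := hρ.1.eigenvalues i₀ with hlam
  set c : ℝ := Fintype.card m * Fintype.card n with hcdef
  have hc : 0 < c := by
    rw [hcdef]
    exact_mod_cast Nat.mul_pos Fintype.card_pos Fintype.card_pos
  have hcC : (c : ℂ) ≠ 0 := by exact_mod_cast hc.ne'
  have hRR : realign Y * (realign Y)ᴴ = (c : ℂ) • choiState Y := by
    rw [choiState, smul_smul, hcdef]
    push_cast
    rw [mul_one_div, div_self, one_smul]
    rw [hcdef] at hcC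
    exact_mod_cast hcC
  have hnorm : ∀ (v : Matrix (m × m) Unit ℂ), ‖vᴴ * realign Y‖ ^ 2 =
      c * ((vᴴ * choiState Y * v).trace).re := by
    intro v
    rw [frobenius_sq_eq_trace, trace_mul_comm, conjTranspose_mul, conjTranspose_conjTranspose,
      Matrix.mul_assoc, ← Matrix.mul_assoc (realign Y), hRR, Matrix.smul_mul, Matrix.mul_smul,
      trace_smul, ← Matrix.mul_assoc, smul_eq_mul, Complex.re_ofReal_mul]
  have hreal : ∀ (K : Matrix m m ℂ) (L : Matrix n n ℂ), ‖Y - K ⊗ₖ L‖ =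
      ‖realign Y - (Matrix.of fun p (_ : Unit) => K p.1 p.2) *
        (Matrix.of fun (_ : Unit) (p : n × n) => L p.1 p.2)‖ := by
    intro K L
    rw [← norm_realign]
    congr 1
    ext p q
    simp [realign, mul_apply]
  refine ⟨1 - lam, h1, h2, h3, h4, ?_, ?_⟩
  -- Eckart-Young, attained: `v` is a top left singular vector of `realign Y`, and `v (vᴴ R)` is the
  -- best rank-one approximation.
  · set v : Matrix (m × m) Unit ℂ := Matrix.of fun p _ => hρ.1.eigenvectorBasis i₀ p with hv
    have hv1 : ‖v‖ ^ 2 = 1 := by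
      have := hρ.1.eigenvectorBasis.orthonormal.1 i₀
      rw [frobenius_sq]
      rw [EuclideanSpace.norm_eq, Real.sqrt_eq_one] at this
      simpa [hv] using this
    have hev : choiState Y * v = (lam : ℂ) • v := by
      ext p u
      have := congrFun (hρ.1.mulVec_eigenvectorBasis i₀) p
      simpa [hv, mul_apply, mulVec, dotProduct] using this
    have hS : ‖vᴴ * realign Y‖ ^ 2 = c * lam := by
      rw [hnorm, Matrix.mul_assoc, hev, Matrix.mul_smul, trace_smul, trace_conjTranspose_mul_self,
        hv1]
      simp
    refine ⟨Matrix.of fun a b => v (a, b) (), Matrix.of fun x y => (vᴴ * realign Y) () (x, y), ?_⟩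
    rw [hreal]
    change ‖realign Y - v * (vᴴ * realign Y)‖ ^ 2 = _
    rw [norm_sub_column_mul_row_sq, trace_mul_comm, trace_conjTranspose_mul_self,
      Complex.ofReal_re, hv1, hS, norm_realign, hY]
    ring
  -- Completing the square: with `‖vᴴ R‖ ≤ √(c lam) ‖v‖` the squared distance is at least `c (1 -
  -- lam) + (√(c lam) - ‖v‖ ‖w‖)²`.
  · intro K L
    rw [hreal]
    set v : Matrix (m × m) Unit ℂ := Matrix.of fun p (_ : Unit) => K p.1 p.2
    set w : Matrix Unit (n × n) ℂ := Matrix.of fun (_ : Unit) (p : n × n) => L p.1 p.2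
    rw [norm_sub_column_mul_row_sq, norm_realign, hY]
    have hS : ‖vᴴ * realign Y‖ ^ 2 ≤ c * (lam * ‖v‖ ^ 2) := by
      rw [hnorm]
      refine mul_le_mul_of_nonneg_left ?_ hc.le
      have hp := (posSemidef_smul_one_sub hρ.1 (c := lam)
        fun i => hmax i (Finset.mem_univ i)).conjTranspose_mul_mul_same v
      have := hp.trace_nonneg
      rw [Matrix.mul_sub, Matrix.sub_mul, Matrix.mul_smul, Matrix.smul_mul, Matrix.mul_one,
        trace_sub, trace_smul, trace_conjTranspose_mul_self] at this
      have h := (Complex.le_def.1 this).1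
      rw [smul_eq_mul, ← Complex.ofReal_mul, Complex.sub_re, Complex.ofReal_re] at h
      simpa using h
    have hx : ((vᴴ * realign Y * wᴴ).trace).re ≤ ‖vᴴ * realign Y‖ * ‖w‖ := by
      refine (Complex.re_le_norm _).trans ?_
      have : (vᴴ * realign Y * wᴴ).trace = (vᴴ * realign Y * wᴴ) () () := by simp [trace]
      rw [this]
      refine (norm_entry_le _ _ _).trans ((frobenius_norm_mul _ _).trans ?_)
      rw [frobenius_norm_conjTranspose]
    have hlam0 : 0 ≤ lam := hρ.eigenvalues_nonneg i₀
    set s := ‖vᴴ * realign Y‖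
    have hs0 : 0 ≤ s := norm_nonneg _
    have h5 : s ≤ Real.sqrt (c * lam) * ‖v‖ := by
      refine le_of_sq_le_sq ?_ (by positivity)
      rw [mul_pow, Real.sq_sqrt (by positivity)]
      linarith
    have h6 : s * ‖w‖ ≤ Real.sqrt (c * lam) * ‖v‖ * ‖w‖ :=
      mul_le_mul_of_nonneg_right h5 (norm_nonneg _)
    have h7 : Real.sqrt (c * lam) ^ 2 = c * lam := Real.sq_sqrt (by positivity)
    nlinarith [sq_nonneg (Real.sqrt (c * lam) - ‖v‖ * ‖w‖)]

end Realign

end MixedBulk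

namespace MixedBulk

/-! ### Scalar asymptotics on the scale `ε² log|ε|`. -/

section Scalar

theorem tendsto_sq_mul_log : Tendsto (fun ε : ℝ => ε ^ 2 * Real.log |ε|) (𝓝[≠] 0) (𝓝 0) := by
  have h : Tendsto (fun ε : ℝ => -(1 / 2) * Real.negMulLog (ε ^ 2)) (𝓝 0) (𝓝 0) := by
    have : Continuous fun ε : ℝ => -(1 / 2) * Real.negMulLog (ε ^ 2) := by fun_prop
    simpa using this.tendsto 0
  refine (h.mono_left nhdsWithin_le_nhds).congr fun ε => ?_
  rw [Real.negMulLog, Real.log_pow, Real.log_abs]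
  push_cast
  ring

theorem sq_isLittleO_sq_mul_log :
    (fun ε : ℝ => ε ^ 2) =o[𝓝[≠] 0] (fun ε : ℝ => ε ^ 2 * Real.log |ε|) := by
  have h : (fun _ : ℝ => (1 : ℝ)) =o[𝓝[≠] 0] (fun ε : ℝ => Real.log |ε|) := by
    rw [isLittleO_one_left_iff]
    refine tendsto_abs_atBot_atTop.comp ?_
    simpa using Real.tendsto_log_nhdsNE_zero
  simpa using (isBigO_refl (fun ε : ℝ => ε ^ 2) (𝓝[≠] 0)).mul_isLittleO h

theorem eventually_log_abs_neg : ∀ᶠ ε : ℝ in 𝓝[≠] 0, Real.log |ε| < 0 := by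
  have := Real.tendsto_log_nhdsNE_zero.eventually_lt_atBot 0
  simpa using this

theorem negMulLog_sq_mul (ε t : ℝ) :
    Real.negMulLog (t * ε ^ 2) = -2 * t * (ε ^ 2 * Real.log |ε|) + ε ^ 2 * Real.negMulLog t := by
  have h : Real.negMulLog (ε ^ 2) = -2 * (ε ^ 2 * Real.log |ε|) := by
    rw [Real.negMulLog, Real.log_pow, Real.log_abs]
    push_cast
    ring
  rw [Real.negMulLog_mul, h]
  ring

/-- Write `q = t ε²` with `t → κ`: the logarithm splits off `-2 t ε² log|ε|`, and the rest is `ε²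
negMulLog t = O(ε²)`. Continuity of `negMulLog` at `0` makes this work for `κ = 0` as well. -/
theorem negMulLog_asymptotics {q : ℝ → ℝ} {κ : ℝ}
    (hq : Tendsto (fun ε => q ε / ε ^ 2) (𝓝[≠] 0) (𝓝 κ)) :
    (fun ε => Real.negMulLog (q ε) + 2 * κ * (ε ^ 2 * Real.log |ε|)) =o[𝓝[≠] 0]
      (fun ε : ℝ => ε ^ 2 * Real.log |ε|) := by
  have h1 : (fun ε => -2 * (q ε / ε ^ 2 - κ) * (ε ^ 2 * Real.log |ε|)) =o[𝓝[≠] 0]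
      (fun ε : ℝ => ε ^ 2 * Real.log |ε|) := by
    have : Tendsto (fun ε => -2 * (q ε / ε ^ 2 - κ)) (𝓝[≠] 0) (𝓝 0) := by
      simpa using (hq.sub_const κ).const_mul (-2)
    simpa using ((isLittleO_one_iff ℝ).2 this).mul_isBigO
      (isBigO_refl (fun ε : ℝ => ε ^ 2 * Real.log |ε|) (𝓝[≠] 0))
  have h2 : (fun ε => ε ^ 2 * Real.negMulLog (q ε / ε ^ 2)) =o[𝓝[≠] 0]
      (fun ε : ℝ => ε ^ 2 * Real.log |ε|) := by
    have h3 := ((Real.continuous_negMulLog.tendsto κ).comp hq).isBigO_one ℝ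
    have h4 := (isBigO_refl (fun ε : ℝ => ε ^ 2) (𝓝[≠] 0)).mul h3
    simp only [mul_one] at h4
    exact h4.trans_isLittleO sq_isLittleO_sq_mul_log
  refine (h1.add h2).congr' ?_ EventuallyEq.rfl
  filter_upwards [self_mem_nhdsWithin] with ε hε
  have hε : ε ≠ 0 := hε
  have h := negMulLog_sq_mul ε (q ε / ε ^ 2)
  rw [div_mul_cancel₀ _ (pow_ne_zero 2 hε)] at h
  rw [h]
  ring

/-- If `-q log q` is at most `2κ ε² log (1/ε)` to leading order, then `q` is at most `κ ε²` to
leading order. -/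
theorem eventually_le_of_negMulLog_le {q g : ℝ → ℝ} {κ r : ℝ} (hκ : 0 ≤ κ) (hr0 : 0 < r)
    (hr1 : r < 1) (hqr : ∀ ε, q ε ≤ r) (hqg : ∀ᶠ ε in 𝓝[≠] 0, Real.negMulLog (q ε) ≤ g ε)
    (hg : (fun ε => g ε + 2 * κ * (ε ^ 2 * Real.log |ε|)) =o[𝓝[≠] 0]
      (fun ε : ℝ => ε ^ 2 * Real.log |ε|)) {δ : ℝ} (hδ : 0 < δ) :
    ∀ᶠ ε in 𝓝[≠] 0, q ε ≤ (κ + δ) * ε ^ 2 := by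
  have hg0 : Tendsto g (𝓝[≠] 0) (𝓝 0) := by
    have h := (hg.isBigO.trans_tendsto tendsto_sq_mul_log).sub
      (tendsto_sq_mul_log.const_mul (2 * κ))
    simpa using h
  have hr : 0 < Real.negMulLog r := by
    rw [Real.negMulLog]
    have := Real.log_neg hr0 hr1
    nlinarith
  have e1 := hg0.eventually_lt_const hr
  have e2 := hg.bound (c := δ / 2) (by positivity)
  have e3 := sq_isLittleO_sq_mul_log.bound
    (c := δ / (1 + |Real.negMulLog (κ + δ)|)) (by positivity)
  filter_upwards [e1, e2, e3, eventually_log_abs_neg, hqg, self_mem_nhdsWithin]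
    with ε h1 h2 h3 h4 h5 h6
  have h6 : ε ≠ 0 := h6
  have hε : 0 < ε ^ 2 := by positivity
  by_contra! hlt
  have ha : 0 < (κ + δ) * ε ^ 2 := by positivity
  -- If `q` exceeded `(κ + δ) ε²`, concavity would bound `negMulLog q` below by its smaller value at
  -- the ends of `[(κ + δ) ε², r]`. At `r` this is a fixed positive number while `g → 0`. At the
  -- other end it beats `g` by the margin that `δ` provides.
  have hmin := Real.concaveOn_negMulLog.min_le_of_mem_Icc (x := (κ + δ) * ε ^ 2) (y := r)
    (z := q ε) ha.le hr0.le ⟨hlt.le, hqr ε⟩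
  set s := ε ^ 2 * Real.log |ε| with hs
  have hs0 : s < 0 := mul_neg_of_pos_of_neg hε h4
  rw [Real.norm_eq_abs, Real.norm_eq_abs, abs_of_neg hs0] at h2 h3
  have h2' := (abs_le.1 h2).2
  rw [abs_of_pos hε, div_mul_eq_mul_div, le_div_iff₀ (by positivity)] at h3
  have hB := neg_abs_le (Real.negMulLog (κ + δ))
  have ha' := negMulLog_sq_mul ε (κ + δ)
  rw [← hs] at ha'
  have hB2 : ε ^ 2 * (-|Real.negMulLog (κ + δ)|) ≤ ε ^ 2 * Real.negMulLog (κ + δ) :=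
    mul_le_mul_of_nonneg_left hB hε.le
  have hlt2 : g ε < Real.negMulLog ((κ + δ) * ε ^ 2) := by
    rw [ha']
    nlinarith
  rcases min_le_iff.1 hmin with h | h <;> linarith

theorem tendsto_norm_div_of_isLittleO {E : Type*} [NormedAddCommGroup E] [NormedSpace ℂ E]
    {f : ℝ → E} {A : E} (h : (fun ε : ℝ => f ε - (ε : ℂ) • A) =o[𝓝[≠] 0] (fun ε : ℝ => ε)) :
    Tendsto (fun ε => ‖f ε‖ / |ε|) (𝓝[≠] 0) (𝓝 ‖A‖) := by
  have h2 : Tendsto (fun ε => ‖f ε - (ε : ℂ) • A‖ / |ε|) (𝓝[≠] 0) (𝓝 0) :=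
    h.norm_norm.tendsto_div_nhds_zero
  rw [tendsto_iff_norm_sub_tendsto_zero]
  refine squeeze_zero' (Eventually.of_forall fun _ => norm_nonneg _) ?_ h2
  filter_upwards [self_mem_nhdsWithin] with ε hε
  have hε : 0 < |ε| := abs_pos.2 hε
  have h3 : ‖f ε‖ / |ε| - ‖A‖ = (‖f ε‖ - ‖(ε : ℂ) • A‖) / |ε| := by
    rw [norm_smul, Complex.norm_real, Real.norm_eq_abs]
    field_simp
  rw [h3, norm_div, Real.norm_eq_abs, Real.norm_eq_abs, abs_abs]
  gcongr
  exact abs_norm_sub_norm_le _ _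

theorem isBigO_of_sub_smul_isLittleO {E : Type*} [NormedAddCommGroup E] [NormedSpace ℂ E]
    {f : ℝ → E} {A : E} (h : (fun ε : ℝ => f ε - (ε : ℂ) • A) =o[𝓝[≠] 0] (fun ε : ℝ => ε)) :
    f =O[𝓝[≠] 0] (fun ε : ℝ => ε) := by
  have h2 : (fun ε : ℝ => (ε : ℂ) • A) =O[𝓝[≠] 0] (fun ε : ℝ => ε) := by
    refine IsBigO.of_bound ‖A‖ (Eventually.of_forall fun ε => ?_)
    rw [norm_smul, Complex.norm_real, mul_comm]
  simpa using h.isBigO.add h2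

theorem sq_isLittleO_id : (fun ε : ℝ => ε * ε) =o[𝓝[≠] 0] (fun ε : ℝ => ε) := by
  have h : (fun ε : ℝ => ε) =o[𝓝[≠] (0 : ℝ)] (fun _ => (1 : ℝ)) :=
    (isLittleO_one_iff ℝ).2 (tendsto_id.mono_left nhdsWithin_le_nhds)
  simpa using h.mul_isBigO (isBigO_refl (fun ε : ℝ => ε) (𝓝[≠] 0))

theorem id_isBigO_one : (fun ε : ℝ => ε) =O[𝓝[≠] (0 : ℝ)] (fun _ => (1 : ℝ)) :=
  ((isLittleO_one_iff ℝ).2 (tendsto_id.mono_left nhdsWithin_le_nhds)).isBigO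

end Scalar

/-! ### Expansion of the coherent information along a differentiable family. -/

section Asymptotics

open scoped Matrix.Norms.Frobenius ComplexOrder

variable {m n : Type*} [Fintype m] [Fintype n] [DecidableEq m] [DecidableEq n]

theorem isBigO_trace {f : ℝ → Matrix m m ℂ} {g : ℝ → ℝ} {l : Filter ℝ} (h : f =O[l] g) :
    (fun x => (f x).trace) =O[l] g :=
  IsBigO.fun_sum fun i _ => isBigO_matrix.1 h i i

theorem isBigO_trRight {f : ℝ → Matrix (m × n) (m × n) ℂ} {g : ℝ → ℝ} {l : Filter ℝ}
    (h : f =O[l] g) : (fun x => trRight (f x)) =O[l] g :=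
  isBigO_matrix.2 fun i j => IsBigO.fun_sum fun x _ => isBigO_matrix.1 h (i, x) (j, x)

theorem isBigO_trLeft {f : ℝ → Matrix (m × n) (m × n) ℂ} {g : ℝ → ℝ} {l : Filter ℝ}
    (h : f =O[l] g) : (fun x => trLeft (f x)) =O[l] g :=
  isBigO_matrix.2 fun i j => IsBigO.fun_sum fun x _ => isBigO_matrix.1 h (x, i) (x, j)

theorem isBigO_conjTranspose {f : ℝ → Matrix m n ℂ} {g : ℝ → ℝ} {l : Filter ℝ} (h : f =O[l] g) :
    (fun x => (f x)ᴴ) =O[l] g := by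
  refine IsBigO.trans (IsBigO.of_bound 1 (Eventually.of_forall fun x => ?_)) h
  rw [frobenius_norm_conjTranspose, one_mul]

theorem isLittleO_conjTranspose {f : ℝ → Matrix m n ℂ} {g : ℝ → ℝ} {l : Filter ℝ}
    (h : f =o[l] g) : (fun x => (f x)ᴴ) =o[l] g := by
  refine IsBigO.trans_isLittleO (IsBigO.of_bound 1 (Eventually.of_forall fun x => ?_)) h
  rw [frobenius_norm_conjTranspose, one_mul]

theorem isBigO_prodDefect {f : ℝ → Matrix (m × n) (m × n) ℂ} {g : ℝ → ℝ} {l : Filter ℝ}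
    (h : f =O[l] g) : (fun x => prodDefect (f x)) =O[l] (fun x => g x * g x) := by
  refine IsBigO.sub ((isBigO_trace h).smul h) ?_
  refine isBigO_matrix.2 fun i j => ?_
  exact (isBigO_matrix.1 (isBigO_trRight h) i.1 j.1).mul (isBigO_matrix.1 (isBigO_trLeft h) i.2 j.2)

theorem expansion_mul {F G : ℝ → Matrix m m ℂ} {A B : Matrix m m ℂ}
    (hF : (fun ε : ℝ => F ε - 1 - (ε : ℂ) • A) =o[𝓝[≠] 0] (fun ε : ℝ => ε))
    (hG : (fun ε : ℝ => G ε - 1 - (ε : ℂ) • B) =o[𝓝[≠] 0] (fun ε : ℝ => ε)) :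
    (fun ε : ℝ => F ε * G ε - 1 - (ε : ℂ) • (A + B)) =o[𝓝[≠] 0] (fun ε : ℝ => ε) := by
  have h1 := (isBigO_of_sub_smul_isLittleO hF).mul (isBigO_of_sub_smul_isLittleO hG)
  refine ((hF.add hG).add (h1.trans_isLittleO sq_isLittleO_id)).congr_left fun ε => ?_
  have h2 : (F ε - 1) * (G ε - 1) = F ε * G ε - 1 - (F ε - 1) - (G ε - 1) := by
    noncomm_ring
  rw [h2]
  module

variable [Nonempty m] [Nonempty n]

theorem isLittleO_tracelessProj {f : ℝ → Matrix (m × n) (m × n) ℂ} {g : ℝ → ℝ} {l : Filter ℝ}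
    (h : f =o[l] g) : (fun x => tracelessProj m n (f x)) =o[l] g := by
  refine IsBigO.trans_isLittleO (IsBigO.of_bound 1 (Eventually.of_forall fun x => ?_)) h
  rw [one_mul]
  exact norm_tracelessProj_le _

/-- The products near `1` have only local tangent directions: when `prodDefect` vanishes, its linear
part equals minus its quadratic part, hence is `O(ε²)`. -/
theorem tracelessProj_product_isLittleO {X : ℝ → Matrix (m × n) (m × n) ℂ}
    (hX : ∀ᶠ ε in 𝓝[≠] 0, prodDefect (X ε) = 0)
    (h : (fun ε => X ε - 1) =O[𝓝[≠] 0] (fun ε : ℝ => ε)) :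
    (fun ε => tracelessProj m n (X ε - 1)) =o[𝓝[≠] 0] (fun ε : ℝ => ε) := by
  have h2 := ((isBigO_prodDefect h).trans_isLittleO sq_isLittleO_id).const_smul_left
    (-(1 / (Fintype.card m * Fintype.card n : ℂ)))
  refine h2.congr' ?_ EventuallyEq.rfl
  filter_upwards [hX] with ε hε
  have hm : (Fintype.card m : ℂ) ≠ 0 := by simp
  have hn : (Fintype.card n : ℂ) ≠ 0 := by simp
  have := prodDefect_one_add (X ε - 1)
  rw [add_sub_cancel, hε] at this
  rw [Pi.smul_apply, ← neg_eq_of_add_eq_zero_right this.symm, neg_smul_neg, smul_smul,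
    one_div_mul_cancel (mul_ne_zero hm hn), one_smul]

/-- The spectral defect of a differentiable family is governed by the part of its derivative that is
traceless on both factors. -/
theorem tendsto_spectral_defect {Y : ℝ → Matrix (m × n) (m × n) ℂ}
    {B : Matrix (m × n) (m × n) ℂ} {q : ℝ → ℝ}
    (hY : (fun ε : ℝ => Y ε - 1 - (ε : ℂ) • B) =o[𝓝[≠] 0] (fun ε : ℝ => ε))
    (hq1 : ∀ ε, ∃ (K : Matrix m m ℂ) (L : Matrix n n ℂ),
        ‖Y ε - K ⊗ₖ L‖ ^ 2 = Fintype.card m * Fintype.card n * q ε)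
    (hq2 : ∀ ε (K : Matrix m m ℂ) (L : Matrix n n ℂ),
        Fintype.card m * Fintype.card n * q ε ≤ ‖Y ε - K ⊗ₖ L‖ ^ 2) :
    Tendsto (fun ε => q ε / ε ^ 2) (𝓝[≠] 0)
      (𝓝 (‖tracelessProj m n B‖ ^ 2 / (Fintype.card m * Fintype.card n))) := by
  have hm : (Fintype.card m : ℂ) ≠ 0 := by simp
  have hn : (Fintype.card n : ℂ) ≠ 0 := by simp
  set c : ℝ := Fintype.card m * Fintype.card n with hcdef
  have hc : 0 < c := by
    rw [hcdef]
    exact_mod_cast Nat.mul_pos Fintype.card_pos Fintype.card_pos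
  have hcC : (Fintype.card m * Fintype.card n : ℂ) = (c : ℂ) := by rw [hcdef]; push_cast; rfl
  have hYO := isBigO_of_sub_smul_isLittleO hY
  have hproj : (fun ε : ℝ => tracelessProj m n (Y ε - 1) - (ε : ℂ) • tracelessProj m n B)
      =o[𝓝[≠] 0] (fun ε : ℝ => ε) := by
    simpa using isLittleO_tracelessProj hY
  -- the upper bound
  have hdef : (fun ε : ℝ => prodDefect (Y ε) - (ε : ℂ) • ((c : ℂ) • tracelessProj m n B))
      =o[𝓝[≠] 0] (fun ε : ℝ => ε) := by
    have h := (hproj.const_smul_left (c : ℂ)).add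
      ((isBigO_prodDefect hYO).trans_isLittleO sq_isLittleO_id)
    refine h.congr_left fun ε => ?_
    have := prodDefect_one_add (Y ε - 1)
    rw [add_sub_cancel, hcC] at this
    rw [this, Pi.smul_apply, smul_sub, smul_comm (ε : ℂ)]
    abel
  have htr : Tendsto (fun ε => ‖(Y ε).trace‖) (𝓝[≠] 0) (𝓝 c) := by
    have h0 : Tendsto (fun ε : ℝ => ε) (𝓝[≠] 0) (𝓝 0) := tendsto_id.mono_left nhdsWithin_le_nhds
    have h1 := (isBigO_trace hYO).trans_tendsto h0
    have h2 := (h1.add_const (c : ℂ)).norm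
    rw [zero_add, Complex.norm_real, Real.norm_eq_abs, abs_of_pos hc] at h2
    refine h2.congr fun ε => ?_
    rw [trace_sub, trace_one, Fintype.card_prod, Nat.cast_mul, hcC, sub_add_cancel]
  have hU : Tendsto (fun ε => (‖prodDefect (Y ε)‖ / |ε|) ^ 2 / ‖(Y ε).trace‖ ^ 2 / c) (𝓝[≠] 0)
      (𝓝 (‖tracelessProj m n B‖ ^ 2 / c)) := by
    have h := (((tendsto_norm_div_of_isLittleO hdef).pow 2).div (htr.pow 2)
      (pow_ne_zero 2 hc.ne')).div_const c
    have e : ‖(c : ℂ) • tracelessProj m n B‖ ^ 2 / c ^ 2 / c = ‖tracelessProj m n B‖ ^ 2 / c := by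
      rw [norm_smul, Complex.norm_real, Real.norm_eq_abs, abs_of_pos hc]
      field_simp
    rw [e] at h
    exact h
  have hupper : ∀ᶠ ε in 𝓝[≠] 0,
      q ε / ε ^ 2 ≤ (‖prodDefect (Y ε)‖ / |ε|) ^ 2 / ‖(Y ε).trace‖ ^ 2 / c := by
    filter_upwards [htr.eventually_ne hc.ne', self_mem_nhdsWithin] with ε h1 h2
    have h2 : ε ≠ 0 := h2
    have h1' : (Y ε).trace ≠ 0 := by simpa using h1
    -- The competing product is built from the partial traces of `Y`. Its error is exactly
    -- `prodDefect (Y ε)` divided by the trace.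
    have h3 := hq2 ε ((Y ε).trace⁻¹ • trRight (Y ε)) (trLeft (Y ε))
    have h4 : Y ε - ((Y ε).trace⁻¹ • trRight (Y ε)) ⊗ₖ trLeft (Y ε) =
        (Y ε).trace⁻¹ • prodDefect (Y ε) := by
      rw [prodDefect, smul_sub, smul_smul, inv_mul_cancel₀ h1', one_smul, smul_kronecker]
    rw [h4, norm_smul, norm_inv, mul_pow, inv_pow] at h3
    rw [div_pow, sq_abs, le_div_iff₀ hc, div_right_comm]
    rw [div_mul_eq_mul_div]
    gcongr
    rw [div_eq_inv_mul, mul_comm]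
    exact h3
  -- the lower bound
  choose K L hKL using hq1
  set E := fun ε => Y ε - K ε ⊗ₖ L ε with hE
  have hEO : E =O[𝓝[≠] 0] (fun ε : ℝ => ε) := by
    set b := ‖tracelessProj m n B‖ ^ 2 / c + 1
    refine IsBigO.of_bound (Real.sqrt (c * b)) ?_
    filter_upwards [hupper, hU.eventually_lt_const (lt_add_one _), self_mem_nhdsWithin]
      with ε h1 h2 h3
    have h3 : ε ≠ 0 := h3
    refine le_of_sq_le_sq ?_ (by positivity)
    rw [hE, hKL, mul_pow, Real.sq_sqrt (by positivity), mul_assoc c b, Real.norm_eq_abs, sq_abs]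
    have := (h1.trans h2.le)
    rw [div_le_iff₀ (by positivity)] at this
    exact mul_le_mul_of_nonneg_left this hc.le
  -- The upper bound puts the nearest product within `O(ε)` of `1`, so the projection hardly sees
  -- it. The projected error is therefore `ε ΠB + o(ε)`, and `Π` is a contraction.
  have hprod := tracelessProj_product_isLittleO (X := fun ε => K ε ⊗ₖ L ε)
    (Eventually.of_forall fun ε => prodDefect_kronecker _ _)
    ((hYO.sub hEO).congr_left fun ε => by simp only [hE]; abel)
  have hprojE : (fun ε : ℝ => tracelessProj m n (E ε) - (ε : ℂ) • tracelessProj m n B)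
      =o[𝓝[≠] 0] (fun ε : ℝ => ε) := by
    refine (hproj.sub hprod).congr_left fun ε => ?_
    have : E ε = (Y ε - 1) - (K ε ⊗ₖ L ε - 1) := by simp only [hE]; abel
    rw [this, map_sub (tracelessProj m n) (Y ε - 1)]
    abel
  have hLo := ((tendsto_norm_div_of_isLittleO hprojE).pow 2).div_const c
  refine tendsto_of_tendsto_of_tendsto_of_le_of_le' hLo hU ?_ hupper
  filter_upwards [self_mem_nhdsWithin] with ε hε
  have hε : ε ≠ 0 := hε
  rw [div_pow, sq_abs, div_right_comm]
  gcongr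
  rw [div_le_iff₀ hc, mul_comm, ← hKL]
  gcongr
  exact norm_tracelessProj_le _

/-- Coherent information in terms of the operator `Y` applied to a maximally entangled input. -/
noncomputable def choiInfo (Y : Matrix (m × n) (m × n) ℂ) : ℝ :=
  entropy (trRight (choiState Y)) - entropy (choiState Y)

theorem trRight_choiState (Y : Matrix (m × n) (m × n) ℂ) :
    trRight (choiState Y) =
      (1 / (Fintype.card m * Fintype.card n) : ℂ) • trRight (Y * Yᴴ) := by
  rw [choiState, trRight_smul]
  congr 1
  ext a b
  simp only [trRight, mul_apply, realign, conjTranspose_apply, Fintype.sum_prod_type]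
  rw [Finset.sum_comm]

theorem trace_trRight_choiState (Y : Matrix (m × n) (m × n) ℂ)
    (hY : ‖Y‖ ^ 2 = Fintype.card m * Fintype.card n) : (trRight (choiState Y)).trace = 1 := by
  rw [trace_trRight, trace_choiState Y hY]

theorem log_card_sub_le_entropy {τ : Matrix m m ℂ} (hτ : τ.PosSemidef) (h1 : τ.trace = 1) :
    Real.log (Fintype.card m) - Fintype.card m * ‖τ - (1 / Fintype.card m : ℂ) • 1‖ ^ 2 ≤
      entropy τ := by
  refine le_trans (le_of_eq ?_) (log_card_le_entropy hτ h1)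
  have hm : (Fintype.card m : ℂ) ≠ 0 := by simp
  have h : ((τ - (1 / Fintype.card m : ℂ) • 1)ᴴ * (τ - (1 / Fintype.card m : ℂ) • 1)).trace =
      (τ * τ).trace - 1 / Fintype.card m := by
    rw [conjTranspose_sub, conjTranspose_smul, conjTranspose_one, hτ.1.eq, Matrix.sub_mul,
      Matrix.mul_sub, Matrix.mul_sub, trace_sub, trace_sub, trace_sub, Matrix.mul_smul,
      Matrix.smul_mul, Matrix.smul_mul, Matrix.mul_smul, trace_smul, trace_smul, trace_smul,
      trace_smul, Matrix.one_mul, Matrix.mul_one, Matrix.one_mul, h1, trace_one]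
    simp
  rw [frobenius_sq_eq_trace, h]
  have hm' : (Fintype.card m : ℝ) ≠ 0 := by simp
  have h2 : ((1 / Fintype.card m : ℂ)).re = 1 / Fintype.card m := by
    rw [← Complex.ofReal_natCast, ← Complex.ofReal_one, ← Complex.ofReal_div, Complex.ofReal_re]
  rw [Complex.sub_re, h2]
  field_simp
  ring

/-- The marginal entropy is `log m + O(ε²)` and the joint entropy is `negMulLog q + O(q)`, so only
`q log q` reaches the order `ε² log|ε|`. -/
theorem choiInfo_asymptotics {Y : ℝ → Matrix (m × n) (m × n) ℂ} {B : Matrix (m × n) (m × n) ℂ}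
    (hY : (fun ε : ℝ => Y ε - 1 - (ε : ℂ) • B) =o[𝓝[≠] 0] (fun ε : ℝ => ε))
    (hnorm : ∀ ε, ‖Y ε‖ ^ 2 = Fintype.card m * Fintype.card n) :
    (fun ε => choiInfo (Y ε) - Real.log (Fintype.card m) -
        2 * (‖tracelessProj m n B‖ ^ 2 / (Fintype.card m * Fintype.card n)) *
          (ε ^ 2 * Real.log |ε|)) =o[𝓝[≠] 0] (fun ε : ℝ => ε ^ 2 * Real.log |ε|) := by
  choose q hq0 hq1 hlo hhi hKL hmin using fun ε => exists_spectral_defect (Y ε) (hnorm ε)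
  have hq := tendsto_spectral_defect hY hKL hmin
  have hYO := isBigO_of_sub_smul_isLittleO hY
  set κ := ‖tracelessProj m n B‖ ^ 2 / (Fintype.card m * Fintype.card n) with hκ
  have hm : (Fintype.card m : ℂ) ≠ 0 := by simp
  have hn : (Fintype.card n : ℂ) ≠ 0 := by simp
  have hτ : (fun ε => trRight (choiState (Y ε)) - (1 / Fintype.card m : ℂ) • 1) =O[𝓝[≠] 0]
      (fun ε : ℝ => ε) := by
    have h1 : (fun ε => Y ε * (Y ε)ᴴ - 1) =O[𝓝[≠] 0] (fun ε : ℝ => ε) := by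
      have h2 := hYO.add ((isBigO_conjTranspose hYO).add
        ((hYO.mul (isBigO_conjTranspose hYO)).trans sq_isLittleO_id.isBigO))
      refine h2.congr_left fun ε => ?_
      rw [conjTranspose_sub, conjTranspose_one]
      noncomm_ring
    have h3 := (isBigO_trRight h1).const_smul_left (1 / (Fintype.card m * Fintype.card n) : ℂ)
    refine h3.congr_left fun ε => ?_
    rw [Pi.smul_apply, trRight_choiState, sub_eq_add_neg (Y ε * (Y ε)ᴴ),
      ← neg_one_smul ℂ (1 : Matrix (m × n) (m × n) ℂ),
      trRight_add, trRight_smul, ← one_kronecker_one, trRight_kronecker, trace_one, smul_add,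
      smul_smul, smul_smul, sub_eq_add_neg, ← neg_smul]
    congr 2
    field_simp
  have hent : (fun ε => choiInfo (Y ε) - Real.log (Fintype.card m) + Real.negMulLog (q ε))
      =O[𝓝[≠] 0] (fun ε : ℝ => ε ^ 2) := by
    have hτ2 : (fun ε => ‖trRight (choiState (Y ε)) - (1 / Fintype.card m : ℂ) • 1‖ ^ 2)
        =O[𝓝[≠] 0] (fun ε : ℝ => ε ^ 2) := hτ.norm_left.pow 2
    have hqO : q =O[𝓝[≠] 0] (fun ε : ℝ => ε ^ 2) := by
      have h := (hq.isBigO_one ℝ).mul (isBigO_refl (fun ε : ℝ => ε ^ 2) (𝓝[≠] 0))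
      simp only [one_mul] at h
      refine h.congr' ?_ EventuallyEq.rfl
      filter_upwards [self_mem_nhdsWithin] with ε hε
      exact div_mul_cancel₀ _ (pow_ne_zero 2 hε)
    have hsum := (hτ2.const_mul_left (Fintype.card m : ℝ)).add
      (hqO.const_mul_left (1 + Fintype.card (m × m) : ℝ))
    refine IsBigO.trans (IsBigO.of_bound 1 (Eventually.of_forall fun ε => ?_)) hsum
    have hps := trRight_posSemidef (choiState_posSemidef (Y ε))
    have htr := trace_trRight_choiState (Y ε) (hnorm ε)
    have h1 := log_card_sub_le_entropy hps htr
    have h2 := entropy_le_log_card hps htr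
    have h3 := hlo ε
    have h4 := hhi ε
    have h5 : 0 ≤ (1 + Fintype.card (m × m) : ℝ) * q ε := mul_nonneg (by positivity) (hq0 ε)
    have h6 : 0 ≤ (Fintype.card m : ℝ) *
        ‖trRight (choiState (Y ε)) - (1 / Fintype.card m : ℂ) • 1‖ ^ 2 := by positivity
    rw [one_mul, Real.norm_eq_abs, Real.norm_eq_abs, abs_of_nonneg (add_nonneg h6 h5), abs_le]
    rw [choiInfo]
    constructor <;> linarith
  refine ((hent.trans_isLittleO sq_isLittleO_sq_mul_log).sub
    (negMulLog_asymptotics hq)).congr_left fun ε => ?_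
  ring

end Asymptotics

end MixedBulk

namespace MixedBulk

/-! ### First-order form of nearly optimal unitaries. -/

section Gauge

open scoped Matrix.Norms.Frobenius ComplexOrder

variable {m n : Type*} [Fintype m] [Fintype n] [DecidableEq m] [DecidableEq n]

/-- Polar decomposition: `U = S K⁻¹` with `S` the positive square root of `Kᴴ K`. -/
theorem exists_unitary_mul_posSemidef (K : Matrix m m ℂ) (hK : K.det ≠ 0) :
    ∃ U : unitaryGroup m ℂ, ((U : Matrix m m ℂ) * K).PosSemidef := by
  have hP : (Kᴴ * K).PosSemidef := posSemidef_conjTranspose_mul_self K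
  set lam := hP.1.eigenvalues with hlam
  set W := hP.1.eigenvectorUnitary with hW
  have hWW : (W : Matrix m m ℂ)ᴴ * (W : Matrix m m ℂ) = 1 := UnitaryGroup.star_mul_self W
  have hWW' : (W : Matrix m m ℂ) * (W : Matrix m m ℂ)ᴴ = 1 := Unitary.coe_mul_star_self W
  have hspec : Kᴴ * K = (W : Matrix m m ℂ) * diagonal (fun i => (lam i : ℂ)) *
      (W : Matrix m m ℂ)ᴴ := hP.1.spectral_theorem
  set S : Matrix m m ℂ := (W : Matrix m m ℂ) * diagonal (fun i => ((Real.sqrt (lam i) : ℝ) : ℂ)) *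
      (W : Matrix m m ℂ)ᴴ with hS
  have hSps : S.PosSemidef := by
    refine PosSemidef.mul_mul_conjTranspose_same (posSemidef_diagonal_iff.2 fun i => ?_) _
    exact Complex.zero_le_real.2 (Real.sqrt_nonneg _)
  have hSS : S * S = Kᴴ * K := by
    rw [hspec, hS]
    have : ∀ D : Matrix m m ℂ, (W : Matrix m m ℂ) * D * (W : Matrix m m ℂ)ᴴ *
        ((W : Matrix m m ℂ) * D * (W : Matrix m m ℂ)ᴴ) =
        (W : Matrix m m ℂ) * (D * D) * (W : Matrix m m ℂ)ᴴ := by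
      intro D
      calc _ = (W : Matrix m m ℂ) * D * ((W : Matrix m m ℂ)ᴴ * (W : Matrix m m ℂ)) * D *
            (W : Matrix m m ℂ)ᴴ := by simp only [Matrix.mul_assoc]
        _ = _ := by rw [hWW]; simp only [Matrix.mul_assoc, Matrix.one_mul]
    rw [this, diagonal_mul_diagonal]
    congr 3
    ext i
    rw [← Complex.ofReal_mul, Real.mul_self_sqrt (hP.eigenvalues_nonneg i)]
  have hKu : IsUnit K.det := isUnit_iff_ne_zero.2 hK
  have hUU : S * K⁻¹ * (S * K⁻¹)ᴴ = 1 := by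
    have hKK : K⁻¹ * K⁻¹ᴴ * (S * S) = 1 := by
      rw [hSS, conjTranspose_nonsing_inv, Matrix.mul_assoc, ← Matrix.mul_assoc _ Kᴴ K,
        nonsing_inv_mul _ (by rw [det_conjTranspose]; exact hKu.star), Matrix.one_mul,
        nonsing_inv_mul _ hKu]
    have h2 : S * (K⁻¹ * K⁻¹ᴴ * S) = 1 := by
      rw [mul_eq_one_comm, Matrix.mul_assoc, hKK]
    rw [conjTranspose_mul, hSps.1.eq, ← h2]
    simp only [Matrix.mul_assoc]
  refine ⟨⟨S * K⁻¹, mem_unitaryGroup_iff.2 hUU⟩, ?_⟩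
  change (S * K⁻¹ * K).PosSemidef
  rwa [Matrix.mul_assoc, nonsing_inv_mul _ hKu, Matrix.mul_one]

/-- `X² - 1 = (X + 1)(X - 1)` and `X + 1 ≥ 1`. It turns control of `Gᴴ G` into control of the
positive factor of `G`. -/
theorem norm_sub_one_le_of_posSemidef {X : Matrix m m ℂ} (hX : X.PosSemidef) :
    ‖X - 1‖ ≤ ‖X * X - 1‖ := by
  have key : ∀ B : Matrix m m ℂ, ‖B‖ ≤ ‖X * B + B‖ := by
    intro B
    refine le_of_sq_le_sq ?_ (norm_nonneg _)
    have h1 : ((X * B)ᴴ * B).trace = (Bᴴ * X * B).trace := by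
      rw [conjTranspose_mul, hX.1.eq]
    have h2 : (Bᴴ * (X * B)).trace = (Bᴴ * X * B).trace := by rw [Matrix.mul_assoc]
    have h3 : 0 ≤ ((Bᴴ * X * B).trace).re :=
      (Complex.le_def.1 (hX.conjTranspose_mul_mul_same B).trace_nonneg).1
    rw [frobenius_sq_eq_trace (X * B + B), conjTranspose_add, Matrix.add_mul, Matrix.mul_add,
      Matrix.mul_add, trace_add, trace_add, trace_add, h1, h2]
    simp only [Complex.add_re, ← frobenius_sq_eq_trace]
    nlinarith [sq_nonneg ‖X * B‖]
  convert key (X - 1) using 2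
  noncomm_ring

/-- The unitary `U₁ ⊗ U₂`. -/
def kronUnitary (U₁ : unitaryGroup m ℂ) (U₂ : unitaryGroup n ℂ) : unitaryGroup (m × n) ℂ :=
  ⟨(U₁ : Matrix m m ℂ) ⊗ₖ (U₂ : Matrix n n ℂ), kronecker_mem_unitary U₁.2 U₂.2⟩

variable [Nonempty m] [Nonempty n]

theorem det_ne_zero_of_norm_sub_one_lt {X : Matrix m m ℂ} (h : ‖X - 1‖ < 1) : X.det ≠ 0 := by
  have := isUnit_one_sub_of_norm_lt_one (x := 1 - X) (by rwa [norm_sub_rev])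
  rw [sub_sub_cancel] at this
  exact ((isUnit_iff_isUnit_det X).1 this).ne_zero

theorem isBigO_unitary_mul {l : Filter ℝ} {P : ℝ → unitaryGroup m ℂ} {f : ℝ → Matrix m m ℂ}
    {g : ℝ → ℝ} (h : f =O[l] g) : (fun ε => (P ε : Matrix m m ℂ) * f ε) =O[l] g :=
  IsBigO.trans (IsBigO.of_bound 1 (Eventually.of_forall fun ε => by
    rw [norm_unitary_mul, one_mul])) h

/-- Unitaries that minimize the spectral defect of `P N` to leading order are determined to first
order, up to product unitaries: they cancel the anti-Hermitian part of the derivative of `N`. -/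
theorem exists_product_gauge {P : ℝ → unitaryGroup (m × n) ℂ} {N : ℝ → Matrix (m × n) (m × n) ℂ}
    {B : Matrix (m × n) (m × n) ℂ} {q : ℝ → ℝ}
    (hN : (fun ε : ℝ => N ε - 1 - (ε : ℂ) • B) =o[𝓝[≠] 0] (fun ε : ℝ => ε))
    (hq1 : ∀ ε, ∃ (K : Matrix m m ℂ) (L : Matrix n n ℂ),
      ‖(P ε : Matrix (m × n) (m × n) ℂ) * N ε - K ⊗ₖ L‖ ^ 2 =
        Fintype.card m * Fintype.card n * q ε)
    (hq : ∀ δ > 0, ∀ᶠ ε in 𝓝[≠] 0, q ε ≤ (‖tracelessProj m n ((1 / 2 : ℂ) • (B + Bᴴ))‖ ^ 2 /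
      (Fintype.card m * Fintype.card n) + δ) * ε ^ 2) :
    ∃ (U₁ : ℝ → unitaryGroup m ℂ) (U₂ : ℝ → unitaryGroup n ℂ),
      (fun ε : ℝ => ((kronUnitary (U₁ ε) (U₂ ε) * P ε : unitaryGroup (m × n) ℂ) :
        Matrix (m × n) (m × n) ℂ) - 1 - (ε : ℂ) • (-(1 / 2 : ℂ) • (B - Bᴴ)))
        =o[𝓝[≠] 0] (fun ε : ℝ => ε) := by
  -- The gauge: rotate the nearest product `K ⊗ L` to its positive polar factor. The singular case
  -- gets the dummy value `1`; it does not occur for small `ε ≠ 0`.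
  have hpol : ∀ ε, ∃ (K : Matrix m m ℂ) (L : Matrix n n ℂ) (U₁ : unitaryGroup m ℂ)
      (U₂ : unitaryGroup n ℂ), ‖(P ε : Matrix (m × n) (m × n) ℂ) * N ε - K ⊗ₖ L‖ ^ 2 =
        Fintype.card m * Fintype.card n * q ε ∧ ((K ⊗ₖ L).det ≠ 0 →
        (((U₁ : Matrix m m ℂ) * K) ⊗ₖ ((U₂ : Matrix n n ℂ) * L)).PosSemidef) := by
    intro ε
    obtain ⟨K, L, h⟩ := hq1 ε
    by_cases hd : (K ⊗ₖ L).det = 0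
    · exact ⟨K, L, 1, 1, h, fun h => absurd hd h⟩
    · rw [det_kronecker] at hd
      obtain ⟨U₁, h1⟩ := exists_unitary_mul_posSemidef K fun h0 => hd (by
        rw [h0, zero_pow Fintype.card_ne_zero, zero_mul])
      obtain ⟨U₂, h2⟩ := exists_unitary_mul_posSemidef L fun h0 => hd (by
        rw [h0, zero_pow Fintype.card_ne_zero, mul_zero])
      exact ⟨K, L, U₁, U₂, h, fun _ => h1.kronecker h2⟩
  choose K L U₁ U₂ hE hX using hpol
  refine ⟨U₁, U₂, ?_⟩
  set c : ℝ := Fintype.card m * Fintype.card n with hcdef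
  have hc : 0 < c := by
    rw [hcdef]
    exact_mod_cast Nat.mul_pos Fintype.card_pos Fintype.card_pos
  set G : ℝ → Matrix (m × n) (m × n) ℂ := fun ε => K ε ⊗ₖ L ε with hG
  set Y : ℝ → Matrix (m × n) (m × n) ℂ := fun ε => (P ε : Matrix (m × n) (m × n) ℂ) * N ε with hY
  set U : ℝ → unitaryGroup (m × n) ℂ := fun ε => kronUnitary (U₁ ε) (U₂ ε) with hU
  set X : ℝ → Matrix (m × n) (m × n) ℂ := fun ε => (U ε : Matrix (m × n) (m × n) ℂ) * G ε with hXdef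
  have hXk : ∀ ε, X ε = ((U₁ ε : Matrix m m ℂ) * K ε) ⊗ₖ ((U₂ ε : Matrix n n ℂ) * L ε) :=
    fun ε => (mul_kronecker_mul _ _ _ _).symm
  set D := (1 / 2 : ℂ) • (B + Bᴴ) with hD
  have hNO := isBigO_of_sub_smul_isLittleO hN
  have hN1 : N =O[𝓝[≠] 0] (fun _ : ℝ => (1 : ℝ)) := by
    have := (hNO.trans id_isBigO_one).add (isBigO_const_const (1 : Matrix (m × n) (m × n) ℂ)
      (one_ne_zero (α := ℝ)) _)
    simpa using this
  have hEO : (fun ε => Y ε - G ε) =O[𝓝[≠] 0] (fun ε : ℝ => ε) := by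
    refine IsBigO.of_bound (Real.sqrt (c * (‖tracelessProj m n D‖ ^ 2 / c + 1))) ?_
    filter_upwards [hq 1 one_pos] with ε h1
    refine le_of_sq_le_sq ?_ (by positivity)
    rw [hE, mul_pow, Real.sq_sqrt (by positivity), mul_assoc c, Real.norm_eq_abs, sq_abs]
    exact mul_le_mul_of_nonneg_left h1 hc.le
  have hPP : ∀ ε, (P ε : Matrix (m × n) (m × n) ℂ)ᴴ * (P ε : Matrix (m × n) (m × n) ℂ) = 1 :=
    fun ε => UnitaryGroup.star_mul_self _
  have hUU : ∀ ε, (U ε : Matrix (m × n) (m × n) ℂ)ᴴ * (U ε : Matrix (m × n) (m × n) ℂ) = 1 :=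
    fun ε => UnitaryGroup.star_mul_self _
  -- `P` may be far from `1`, so `G` is not yet controlled, but `Yᴴ Y = Nᴴ N` does not involve `P`.
  have hGG : (fun ε => (G ε)ᴴ * G ε - 1) =O[𝓝[≠] 0] (fun ε : ℝ => ε) := by
    have hNN : (fun ε => (N ε)ᴴ * N ε - 1) =O[𝓝[≠] 0] (fun ε : ℝ => ε) := by
      have h := (isBigO_conjTranspose hNO).mul hN1
      simp only [mul_one] at h
      refine (hNO.add h).congr_left fun ε => ?_
      rw [conjTranspose_sub, conjTranspose_one]
      noncomm_ring
    have hY1 : Y =O[𝓝[≠] 0] (fun _ : ℝ => (1 : ℝ)) := isBigO_unitary_mul hN1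
    have h1 := (isBigO_conjTranspose hY1).mul hEO
    have h2 := (isBigO_conjTranspose hEO).mul hY1
    have h3 := ((isBigO_conjTranspose hEO).mul hEO).trans sq_isLittleO_id.isBigO
    simp only [mul_one, one_mul] at h1 h2
    refine (((hNN.sub h1).sub h2).add h3).congr_left fun ε => ?_
    have : (Y ε)ᴴ * Y ε = (N ε)ᴴ * N ε := by
      simp only [hY]
      rw [conjTranspose_mul, Matrix.mul_assoc, ← Matrix.mul_assoc _ _ (N ε), hPP, Matrix.one_mul]
    rw [← this, conjTranspose_sub]
    noncomm_ring
  have hdet : ∀ᶠ ε in 𝓝[≠] 0, (X ε).PosSemidef := by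
    have h0 : Tendsto (fun ε : ℝ => ‖(G ε)ᴴ * G ε - 1‖) (𝓝[≠] 0) (𝓝 0) :=
      (hGG.norm_left).trans_tendsto (tendsto_id.mono_left nhdsWithin_le_nhds)
    filter_upwards [h0.eventually_lt_const one_pos] with ε hε
    rw [hXk]
    refine hX ε fun h => det_ne_zero_of_norm_sub_one_lt hε ?_
    rw [det_mul]
    simp only [hG]
    rw [h, mul_zero]
  have hXO : (fun ε => X ε - 1) =O[𝓝[≠] 0] (fun ε : ℝ => ε) := by
    refine IsBigO.trans (IsBigO.of_bound 1 ?_) hGG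
    filter_upwards [hdet] with ε hε
    rw [one_mul]
    refine (norm_sub_one_le_of_posSemidef hε).trans (le_of_eq ?_)
    have : X ε * X ε = (G ε)ᴴ * G ε := by
      conv_lhs => rw [← hε.1.eq]
      conv_lhs => enter [2]; rw [hε.1.eq]
      simp only [hXdef]
      rw [conjTranspose_mul, Matrix.mul_assoc, ← Matrix.mul_assoc _ _ (G ε), hUU, Matrix.one_mul]
    rw [this]
  -- the first-order expansion of the gauge-fixed unitary
  set E : ℝ → Matrix (m × n) (m × n) ℂ := fun ε =>
    (U ε : Matrix (m × n) (m × n) ℂ) * (Y ε - G ε) with hEdef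
  have hEO' : E =O[𝓝[≠] 0] (fun ε : ℝ => ε) := isBigO_unitary_mul hEO
  set Q : ℝ → unitaryGroup (m × n) ℂ := fun ε => U ε * P ε with hQ
  set A : ℝ → Matrix (m × n) (m × n) ℂ := fun ε => (Q ε : Matrix (m × n) (m × n) ℂ) - 1 with hA
  have hQN : ∀ ε, (Q ε : Matrix (m × n) (m × n) ℂ) * N ε = X ε + E ε := by
    intro ε
    simp only [hQ, hXdef, hEdef, hY]
    rw [Matrix.mul_sub, add_sub_cancel, UnitaryGroup.mul_val, Matrix.mul_assoc]
  have hAeq : ∀ ε, A ε = (X ε - 1) + E ε - (Q ε : Matrix (m × n) (m × n) ℂ) * (N ε - 1) := by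
    intro ε
    rw [Matrix.mul_sub, hQN, Matrix.mul_one]
    simp only [hA]
    abel
  have hAO : A =O[𝓝[≠] 0] (fun ε : ℝ => ε) :=
    ((hXO.add hEO').sub (isBigO_unitary_mul (P := Q) hNO)).congr_left fun ε => (hAeq ε).symm
  -- `w` is the remainder in the linearization `A ≈ (X - 1) + E - εB` of `Q N = X + E`. Its
  -- Hermitian and anti-Hermitian parts are used separately.
  set w : ℝ → Matrix (m × n) (m × n) ℂ := fun ε => A ε - ((X ε - 1) + E ε - (ε : ℂ) • B) with hw
  have hwo : w =o[𝓝[≠] 0] (fun ε : ℝ => ε) := by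
    refine (hN.add ((hAO.mul hNO).trans_isLittleO sq_isLittleO_id)).neg_left.congr_left fun ε => ?_
    have h1 : A ε - (X ε - 1 + E ε - (ε : ℂ) • B) = (ε : ℂ) • B - (A ε + 1) * (N ε - 1) := by
      have h2 : (Q ε : Matrix (m × n) (m × n) ℂ) = A ε + 1 := by simp only [hA]; abel
      rw [← h2]
      conv_lhs => rw [hAeq]
      abel
    simp only [hw]
    rw [h1]
    noncomm_ring
  have hAH : (fun ε => A ε + (A ε)ᴴ) =o[𝓝[≠] 0] (fun ε : ℝ => ε) := by
    refine ((hAO.mul (isBigO_conjTranspose hAO)).trans_isLittleO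
      sq_isLittleO_id).neg_left.congr_left fun ε => ?_
    have h : (Q ε : Matrix (m × n) (m × n) ℂ) * (Q ε : Matrix (m × n) (m × n) ℂ)ᴴ = 1 :=
      Unitary.coe_mul_star_self _
    have h2 : (A ε + 1) * (A ε + 1)ᴴ = 1 := by simpa [hA] using h
    rw [conjTranspose_add, conjTranspose_one] at h2
    have h3 : A ε * (A ε)ᴴ + (A ε + (A ε)ᴴ) = 0 := by
      have : (A ε + 1) * ((A ε)ᴴ + 1) = A ε * (A ε)ᴴ + (A ε + (A ε)ᴴ) + 1 := by noncomm_ring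
      rw [this] at h2
      simpa using h2
    exact neg_eq_of_add_eq_zero_right h3
  set H : ℝ → Matrix (m × n) (m × n) ℂ := fun ε => (1 / 2 : ℂ) • (E ε + (E ε)ᴴ) with hH
  set S : ℝ → Matrix (m × n) (m × n) ℂ := fun ε => (1 / 2 : ℂ) • (E ε - (E ε)ᴴ) with hS
  have hcs : star (1 / 2 : ℂ) = 1 / 2 := by simp
  -- Hermitian part of the linearized equation: `A` drops out because `Q` is unitary.
  have hHo : (fun ε : ℝ => H ε - (ε : ℂ) • D + (X ε - 1)) =o[𝓝[≠] 0] (fun ε : ℝ => ε) := by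
    refine ((hAH.sub (hwo.add (isLittleO_conjTranspose hwo))).const_smul_left
      (1 / 2 : ℂ)).congr' ?_ EventuallyEq.rfl
    filter_upwards [hdet] with ε hε
    have hXh : (X ε)ᴴ = X ε := hε.1
    simp only [Pi.smul_apply, hw, hH, hD, conjTranspose_sub, conjTranspose_add,
      conjTranspose_smul, conjTranspose_one, hXh]
    simp only [RCLike.star_def, Complex.conj_ofReal]
    module
  have hprojH : (fun ε : ℝ => tracelessProj m n (H ε) - (ε : ℂ) • tracelessProj m n D)
      =o[𝓝[≠] 0] (fun ε : ℝ => ε) := by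
    have h1 := tracelessProj_product_isLittleO
      (Eventually.of_forall fun ε => by rw [hXk]; exact prodDefect_kronecker _ _) hXO
    refine ((isLittleO_tracelessProj hHo).sub h1).congr_left fun ε => ?_
    rw [map_add, map_sub, (tracelessProj m n).map_smul (ε : ℂ) D, add_sub_cancel_right]
  have hlow := (tendsto_norm_div_of_isLittleO hprojH).pow 2
  -- By `hprojH`, the Hermitian part of `E` already has squared norm at least about `ε² ‖ΠD‖²`,
  -- while near-minimality caps `‖E‖²` at about the same amount. Nothing of order `ε` is left for
  -- `S`. The two slacks `δ²/2` add up to `δ²`.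
  have hSo : S =o[𝓝[≠] 0] (fun ε : ℝ => ε) := by
    refine IsLittleO.of_bound fun δ hδ => ?_
    have e1 := hq (δ ^ 2 / (2 * c)) (by positivity)
    have e2 := hlow.eventually_const_lt (u := ‖tracelessProj m n D‖ ^ 2 - δ ^ 2 / 2)
      (by have : 0 < δ ^ 2 := by positivity
          linarith)
    filter_upwards [e1, e2, self_mem_nhdsWithin] with ε h1 h2 h3
    have h3 : ε ≠ 0 := h3
    have hε : 0 < ε ^ 2 := by positivity
    refine le_of_sq_le_sq ?_ (by positivity)
    have hsum : ‖E ε‖ ^ 2 = ‖H ε‖ ^ 2 + ‖S ε‖ ^ 2 := by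
      rw [← norm_sq_hermitian_add]
      · congr 2
        simp only [hH, hS]
        module
      · simp only [hH, conjTranspose_smul, conjTranspose_add, conjTranspose_conjTranspose, hcs]
        rw [add_comm]
      · simp only [hS, conjTranspose_smul, conjTranspose_sub, conjTranspose_conjTranspose, hcs]
        module
    have hEn : ‖E ε‖ ^ 2 = c * q ε := by
      simp only [hEdef]
      rw [norm_unitary_mul]
      exact hE ε
    have hHn : (‖tracelessProj m n D‖ ^ 2 - δ ^ 2 / 2) * ε ^ 2 ≤ ‖H ε‖ ^ 2 := by
      rw [div_pow, sq_abs, lt_div_iff₀ hε] at h2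
      refine h2.le.trans ?_
      gcongr
      exact norm_tracelessProj_le _
    have h4 := mul_le_mul_of_nonneg_left h1 hc.le
    have h5 : c * ((‖tracelessProj m n D‖ ^ 2 / c + δ ^ 2 / (2 * c)) * ε ^ 2) =
        (‖tracelessProj m n D‖ ^ 2 + δ ^ 2 / 2) * ε ^ 2 := by field_simp
    rw [h5] at h4
    rw [mul_pow, Real.norm_eq_abs, sq_abs]
    linarith
  -- Anti-Hermitian part of the linearized equation: the positive `X` cancels and `S` is negligible,
  -- so only the anti-Hermitian part of `-εB` remains.
  have hfin : (fun ε : ℝ => (1 / 2 : ℂ) • (A ε + (A ε)ᴴ) +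
      (S ε + (1 / 2 : ℂ) • (w ε - (w ε)ᴴ))) =o[𝓝[≠] 0] (fun ε : ℝ => ε) :=
    (hAH.const_smul_left (1 / 2 : ℂ)).add
      (hSo.add ((hwo.sub (isLittleO_conjTranspose hwo)).const_smul_left (1 / 2 : ℂ)))
  refine hfin.congr' ?_ EventuallyEq.rfl
  filter_upwards [hdet] with ε hε
  have hXh : (X ε)ᴴ = X ε := hε.1
  change _ = A ε - _
  simp only [hS, hw, conjTranspose_sub, conjTranspose_add, conjTranspose_smul, conjTranspose_one,
    hXh]
  simp only [RCLike.star_def, Complex.conj_ofReal]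
  module

end Gauge

end MixedBulk

namespace MixedBulk

/-! ### The unitary `e^{iεH}` to first order. -/

section Exponential

variable {n : Type*} [Fintype n] [DecidableEq n]

theorem expI_zero (H : Matrix n n ℂ) : expI H 0 = 1 := by
  simp [expI, NormedSpace.exp_zero]

theorem expI_mem_unitaryGroup {H : Matrix n n ℂ} (hH : H.IsHermitian) (ε : ℝ) :
    expI H ε ∈ unitaryGroup n ℂ := by
  rw [mem_unitaryGroup_iff, expI, star_eq_conjTranspose, ← exp_conjTranspose, conjTranspose_smul,
    hH.eq, ← Matrix.exp_add_of_commute]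
  · rw [← add_smul]
    simp
  · exact ((Commute.refl H).smul_left _).smul_right _

open scoped Matrix.Norms.Frobenius in
theorem expI_expansion (H : Matrix n n ℂ) :
    (fun ε : ℝ => expI H ε - 1 - (ε : ℂ) • (Complex.I • H)) =o[𝓝[≠] 0] (fun ε : ℝ => ε) := by
  have h := hasDerivAt_exp_smul_const (𝕂 := ℝ) (Complex.I • H) (0 : ℝ)
  rw [zero_smul, NormedSpace.exp_zero, one_mul, hasDerivAt_iff_isLittleO] at h
  refine (h.mono nhdsWithin_le_nhds).congr (fun ε => ?_) (fun ε => sub_zero ε)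
  rw [zero_smul, NormedSpace.exp_zero, sub_zero]
  have : ∀ A : Matrix n n ℂ, (ε : ℂ) • A = ε • A := fun A => by ext; simp
  rw [expI, mul_comm, ← smul_smul, this]
  rfl

end Exponential

/-! ### Continuity of the entropy and compactness of the unitary group. -/

section Continuity

open scoped ComplexOrder

variable {n : Type*} [Fintype n] [DecidableEq n]

theorem eigenvalues_le_one {ρ : Matrix n n ℂ} (hρ : ρ.PosSemidef) (h1 : ρ.trace = 1) (i : n) :
    hρ.1.eigenvalues i ≤ 1 := by
  rw [← sum_eigenvalues_eq_one hρ.1 h1]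
  exact Finset.single_le_sum (fun j _ => hρ.eigenvalues_nonneg j) (Finset.mem_univ i)

/-- Polynomials approximate `negMulLog` uniformly on `[0, 1]`, which contains all eigenvalues, and
traces of polynomials in `ρ` are continuous. This avoids tracking eigenvalues. -/
theorem continuous_entropy_comp {X : Type*} [TopologicalSpace X] {ρ : X → Matrix n n ℂ}
    (hc : Continuous ρ) (hρ : ∀ x, (ρ x).PosSemidef) (h1 : ∀ x, (ρ x).trace = 1) :
    Continuous fun x => entropy (ρ x) := by
  refine continuous_of_uniform_approx_of_continuous fun u hu => ?_
  obtain ⟨δ, hδ, hu⟩ := Metric.mem_uniformity_dist.1 hu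
  obtain ⟨p, hp⟩ := exists_polynomial_near_of_continuousOn 0 1 Real.negMulLog
    Real.continuous_negMulLog.continuousOn (δ / (Fintype.card n + 1)) (by positivity)
  refine ⟨fun x => ((Polynomial.aeval (ρ x) p).trace).re, ?_, fun x => hu ?_⟩
  · have : Continuous fun x => Polynomial.aeval (ρ x) p := by
      simp only [Polynomial.aeval_eq_sum_range]
      exact continuous_finsetSum _ fun i _ => (hc.pow i).const_smul (p.coeff i)
    exact Complex.continuous_re.comp this.matrix_trace
  · have hpoly := trace_cfc_eq_sum (hρ x).1 (fun y => p.eval y)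
    have hcfc : cfc (fun y : ℝ => p.eval y) (ρ x) = Polynomial.aeval (ρ x) p :=
      cfc_polynomial (R := ℝ) p (ρ x) (hρ x).1
    rw [hcfc] at hpoly
    beta_reduce
    rw [hpoly, entropy_eq_sum (hρ x).1, ← Complex.ofReal_sum, Complex.ofReal_re, Real.dist_eq,
      ← Finset.sum_sub_distrib]
    calc _ ≤ ∑ i, |Real.negMulLog ((hρ x).1.eigenvalues i) - p.eval ((hρ x).1.eigenvalues i)| :=
          Finset.abs_sum_le_sum_abs _ _
      _ ≤ ∑ _i : n, δ / (Fintype.card n + 1) := by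
          refine Finset.sum_le_sum fun i _ => ?_
          rw [abs_sub_comm]
          exact (hp _ ⟨(hρ x).eigenvalues_nonneg i, eigenvalues_le_one (hρ x) (h1 x) i⟩).le
      _ < δ := by
          rw [Finset.sum_const, Finset.card_univ, nsmul_eq_mul, ← mul_div_assoc,
            div_lt_iff₀ (by positivity)]
          linarith

theorem isCompact_unitaryGroup : IsCompact (unitaryGroup n ℂ : Set (Matrix n n ℂ)) := by
  have hK : IsCompact (Set.univ.pi fun _ : n => Set.univ.pi fun _ : n =>
      Metric.closedBall (0 : ℂ) 1) :=
    isCompact_univ_pi fun _ => isCompact_univ_pi fun _ => isCompact_closedBall _ _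
  refine hK.of_isClosed_subset ?_ fun U hU i _ j _ => ?_
  · have : (unitaryGroup n ℂ : Set (Matrix n n ℂ)) = {U | U * star U = 1} := by
      ext U; exact mem_unitaryGroup_iff
    rw [this]
    exact isClosed_eq (continuous_id.matrix_mul continuous_id.matrix_conjTranspose)
      continuous_const
  · rw [mem_closedBall_zero_iff]
    exact entry_norm_bound_of_unitary hU i j

end Continuity

/-! ### Invariances and maximizers of `choiInfo`. -/

section ChoiInfo

variable {m n : Type*} [Fintype m] [Fintype n] [DecidableEq m] [DecidableEq n]

theorem realign_kronecker_mul (A : Matrix m m ℂ) (B : Matrix n n ℂ)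
    (Y : Matrix (m × n) (m × n) ℂ) :
    realign ((A ⊗ₖ B) * Y) = (A ⊗ₖ (1 : Matrix m m ℂ)) * realign Y * (Bᵀ ⊗ₖ (1 : Matrix n n ℂ)) := by
  ext ⟨a, b⟩ ⟨x, y⟩
  simp only [realign, mul_apply, kroneckerMap_apply, Fintype.sum_prod_type, one_apply,
    transpose_apply, mul_ite, mul_one, mul_zero, ite_mul, zero_mul, Finset.sum_ite_eq,
    Finset.sum_ite_eq', Finset.mem_univ, if_true, Finset.sum_mul]
  rw [Finset.sum_comm]
  refine Finset.sum_congr rfl fun x' _ => Finset.sum_congr rfl fun a' _ => ?_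
  ring

theorem realign_mul_one_kronecker (B : Matrix n n ℂ) (Y : Matrix (m × n) (m × n) ℂ) :
    realign (Y * ((1 : Matrix m m ℂ) ⊗ₖ B)) = realign Y * ((1 : Matrix n n ℂ) ⊗ₖ B) := by
  ext ⟨a, b⟩ ⟨x, y⟩
  simp [realign, mul_apply, Fintype.sum_prod_type, one_apply]

theorem trRight_kronecker_one_conj (U : Matrix m m ℂ) (ρ : Matrix (m × n) (m × n) ℂ) :
    trRight ((U ⊗ₖ (1 : Matrix n n ℂ)) * ρ * (U ⊗ₖ (1 : Matrix n n ℂ))ᴴ) =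
      U * trRight ρ * Uᴴ := by
  ext a b
  simp only [trRight, mul_apply, kroneckerMap_apply, Fintype.sum_prod_type, one_apply,
    conjTranspose_apply, mul_ite, mul_one, mul_zero, ite_mul, zero_mul, Finset.sum_ite_eq,
    Finset.mem_univ, if_true, Finset.sum_mul, Finset.mul_sum, apply_ite star, star_zero]
  rw [Finset.sum_comm]
  refine Finset.sum_congr rfl fun x' _ => ?_
  rw [Finset.sum_comm]

theorem mul_conjTranspose_mul_unitary {p : Type*} [Fintype p] (R : Matrix p n ℂ)
    (U : Matrix n n ℂ) (hU : U * Uᴴ = 1) : (R * U) * (R * U)ᴴ = R * Rᴴ := by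
  rw [conjTranspose_mul, Matrix.mul_assoc, ← Matrix.mul_assoc U, hU, Matrix.one_mul]

theorem choiState_kronUnitary_mul (U₁ : unitaryGroup m ℂ) (U₂ : unitaryGroup n ℂ)
    (Y : Matrix (m × n) (m × n) ℂ) :
    choiState ((kronUnitary U₁ U₂ : Matrix (m × n) (m × n) ℂ) * Y) =
      ((kronUnitary U₁ (1 : unitaryGroup m ℂ)) : Matrix (m × m) (m × m) ℂ) * choiState Y *
      ((kronUnitary U₁ (1 : unitaryGroup m ℂ)) : Matrix (m × m) (m × m) ℂ)ᴴ := by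
  have h2 : ((U₂ : Matrix n n ℂ)ᵀ ⊗ₖ (1 : Matrix n n ℂ)) *
      ((U₂ : Matrix n n ℂ)ᵀ ⊗ₖ (1 : Matrix n n ℂ))ᴴ = 1 := by
    rw [conjTranspose_kronecker, ← mul_kronecker_mul, conjTranspose_one, Matrix.mul_one,
      ← one_kronecker_one]
    congr 1
    change (U₂ : Matrix n n ℂ)ᵀ * ((U₂ : Matrix n n ℂ)ᴴ)ᵀ = 1
    rw [← transpose_mul, ← star_eq_conjTranspose,
      UnitaryGroup.star_mul_self, transpose_one]
  change choiState (((U₁ : Matrix m m ℂ) ⊗ₖ (U₂ : Matrix n n ℂ)) * Y) =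
    ((U₁ : Matrix m m ℂ) ⊗ₖ (1 : Matrix m m ℂ)) * choiState Y *
      ((U₁ : Matrix m m ℂ) ⊗ₖ (1 : Matrix m m ℂ))ᴴ
  rw [choiState, realign_kronecker_mul, mul_conjTranspose_mul_unitary _ _ h2, choiState,
    Matrix.mul_smul, Matrix.smul_mul, conjTranspose_mul]
  simp only [Matrix.mul_assoc]

theorem choiInfo_kronUnitary_mul (U₁ : unitaryGroup m ℂ) (U₂ : unitaryGroup n ℂ)
    (Y : Matrix (m × n) (m × n) ℂ) :
    choiInfo ((kronUnitary U₁ U₂ : Matrix (m × n) (m × n) ℂ) * Y) = choiInfo Y := by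
  rw [choiInfo, choiState_kronUnitary_mul, entropy_unitary_conj _ (choiState_posSemidef Y).1]
  change entropy (trRight (((U₁ : Matrix m m ℂ) ⊗ₖ (1 : Matrix m m ℂ)) * choiState Y *
      ((U₁ : Matrix m m ℂ) ⊗ₖ (1 : Matrix m m ℂ))ᴴ)) - _ = _
  rw [trRight_kronecker_one_conj,
    entropy_unitary_conj _ (trRight_posSemidef (choiState_posSemidef Y)).1, choiInfo]

/-- After reduction to `A` this is why the recovery on `Ā` is irrelevant. -/
theorem choiInfo_mul_one_kronecker (U : unitaryGroup n ℂ) (Y : Matrix (m × n) (m × n) ℂ) :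
    choiInfo (Y * ((1 : Matrix m m ℂ) ⊗ₖ (U : Matrix n n ℂ))) = choiInfo Y := by
  have h : choiState (Y * ((1 : Matrix m m ℂ) ⊗ₖ (U : Matrix n n ℂ))) = choiState Y := by
    rw [choiState, realign_mul_one_kronecker, mul_conjTranspose_mul_unitary, choiState]
    rw [conjTranspose_kronecker, ← mul_kronecker_mul, conjTranspose_one, Matrix.mul_one,
      ← star_eq_conjTranspose]
    rw [mem_unitaryGroup_iff.1 U.2, one_kronecker_one]
  rw [choiInfo, choiInfo, h]

theorem continuous_trRight : Continuous (trRight : Matrix (m × n) (m × n) ℂ → Matrix m m ℂ) :=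
  continuous_matrix fun _ _ => continuous_finsetSum _ fun _ _ => continuous_id.matrix_elem _ _

theorem continuous_choiState :
    Continuous (choiState : Matrix (m × n) (m × n) ℂ → Matrix (m × m) (m × m) ℂ) := by
  have h : Continuous (realign : Matrix (m × n) (m × n) ℂ → Matrix (m × m) (n × n) ℂ) :=
    continuous_matrix fun _ _ => continuous_id.matrix_elem _ _
  exact (h.matrix_mul h.matrix_conjTranspose).const_smul
    (1 / (Fintype.card m * Fintype.card n) : ℂ)

variable [Nonempty m] [Nonempty n]

open scoped Matrix.Norms.Frobenius in
theorem exists_maximal_unitary (N : Matrix (m × n) (m × n) ℂ)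
    (hN : ‖N‖ ^ 2 = Fintype.card m * Fintype.card n) :
    ∃ P : unitaryGroup (m × n) ℂ, ∀ P' : unitaryGroup (m × n) ℂ,
      choiInfo ((P' : Matrix (m × n) (m × n) ℂ) * N) ≤
        choiInfo ((P : Matrix (m × n) (m × n) ℂ) * N) := by
  have hP : ∀ P : unitaryGroup (m × n) ℂ,
      ‖(P : Matrix (m × n) (m × n) ℂ) * N‖ ^ 2 = Fintype.card m * Fintype.card n := fun P => by
    rw [norm_unitary_mul, hN]
  have hc : Continuous fun P : unitaryGroup (m × n) ℂ =>
      choiState ((P : Matrix (m × n) (m × n) ℂ) * N) :=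
    continuous_choiState.comp (continuous_subtype_val.matrix_mul continuous_const)
  have hcont : Continuous fun P : unitaryGroup (m × n) ℂ =>
      choiInfo ((P : Matrix (m × n) (m × n) ℂ) * N) :=
    (continuous_entropy_comp (continuous_trRight.comp hc)
      (fun P => trRight_posSemidef (choiState_posSemidef _))
      (fun P => trace_trRight_choiState _ (hP P))).sub
    (continuous_entropy_comp hc (fun P => choiState_posSemidef _)
      (fun P => trace_choiState _ (hP P)))
  have : CompactSpace (unitaryGroup (m × n) ℂ) := isCompact_iff_compactSpace.1
    isCompact_unitaryGroup
  obtain ⟨P, -, h⟩ := isCompact_univ.exists_isMaxOn ⟨1, Set.mem_univ _⟩ hcont.continuousOn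
  exact ⟨P, fun P' => h (Set.mem_univ P')⟩

open scoped Matrix.Norms.Frobenius

theorem choiInfo_le_log_card (Y : Matrix (m × n) (m × n) ℂ)
    (hY : ‖Y‖ ^ 2 = Fintype.card m * Fintype.card n) :
    choiInfo Y ≤ Real.log (Fintype.card m) - entropy (choiState Y) :=
  sub_le_sub_right (entropy_le_log_card (trRight_posSemidef (choiState_posSemidef Y))
    (trace_trRight_choiState Y hY)) _

theorem norm_one_sq : ‖(1 : Matrix (m × n) (m × n) ℂ)‖ ^ 2 = Fintype.card m * Fintype.card n := by
  rw [frobenius_sq_eq_trace, conjTranspose_one, Matrix.one_mul, trace_one, Fintype.card_prod]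
  simp

/-- The identity reaches the absolute upper bound `log m`. It allows the value at `ε = 0` of an
optimal family to be set to `1`. -/
theorem choiInfo_le_one (Y : Matrix (m × n) (m × n) ℂ)
    (hY : ‖Y‖ ^ 2 = Fintype.card m * Fintype.card n) :
    choiInfo Y ≤ choiInfo (1 : Matrix (m × n) (m × n) ℂ) := by
  have h0 : 0 ≤ entropy (choiState Y) := by
    rw [entropy_eq_sum (choiState_posSemidef Y).1]
    exact Finset.sum_nonneg fun i _ => Real.negMulLog_nonneg
      ((choiState_posSemidef Y).eigenvalues_nonneg i)
      (eigenvalues_le_one (choiState_posSemidef Y) (trace_choiState Y hY) i)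
  refine (choiInfo_le_log_card Y hY).trans ?_
  have h1 := norm_one_sq (m := m) (n := n)
  obtain ⟨q, hq0, -, -, hhi, -, hmin⟩ := exists_spectral_defect (1 : Matrix (m × n) (m × n) ℂ) h1
  have hc : (0 : ℝ) < Fintype.card m * Fintype.card n := by
    exact_mod_cast Nat.mul_pos Fintype.card_pos Fintype.card_pos
  have hq : q = 0 := by
    have := hmin 1 1
    rw [one_kronecker_one, sub_self, norm_zero] at this
    nlinarith
  rw [hq] at hhi
  have h2 := log_card_sub_le_entropy (trRight_posSemidef (choiState_posSemidef
    (1 : Matrix (m × n) (m × n) ℂ))) (trace_trRight_choiState _ h1)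
  have hm : (Fintype.card m : ℂ) ≠ 0 := by simp
  have hn : (Fintype.card n : ℂ) ≠ 0 := by simp
  have h3 : trRight (choiState (1 : Matrix (m × n) (m × n) ℂ)) = (1 / Fintype.card m : ℂ) • 1 := by
    rw [trRight_choiState, conjTranspose_one, Matrix.one_mul, ← one_kronecker_one,
      trRight_kronecker, trace_one, smul_smul]
    congr 1
    field_simp
  rw [h3, sub_self, norm_zero] at h2
  simp only [Real.negMulLog_zero, mul_zero, add_zero] at hhi
  rw [choiInfo, h3]
  linarith

/-- A differentiable choice of unitaries that maximize the coherent information. -/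
theorem exists_optimal_unitary_family {N : ℝ → Matrix (m × n) (m × n) ℂ}
    {B : Matrix (m × n) (m × n) ℂ}
    (hN : (fun ε : ℝ => N ε - 1 - (ε : ℂ) • B) =o[𝓝[≠] 0] (fun ε : ℝ => ε))
    (hN0 : N 0 = 1) (hnorm : ∀ ε, ‖N ε‖ ^ 2 = Fintype.card m * Fintype.card n) :
    ∃ P : ℝ → unitaryGroup (m × n) ℂ, P 0 = 1 ∧
      (fun ε : ℝ => (P ε : Matrix (m × n) (m × n) ℂ) - 1 - (ε : ℂ) • (-(1 / 2 : ℂ) • (B - Bᴴ)))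
        =o[𝓝[≠] 0] (fun ε : ℝ => ε) ∧
      ∀ ε (P' : unitaryGroup (m × n) ℂ), choiInfo ((P' : Matrix (m × n) (m × n) ℂ) * N ε) ≤
        choiInfo ((P ε : Matrix (m × n) (m × n) ℂ) * N ε) := by
  choose P hPmax using fun ε => exists_maximal_unitary (N ε) (hnorm ε)
  have hPn : ∀ (P : unitaryGroup (m × n) ℂ) ε,
      ‖(P : Matrix (m × n) (m × n) ℂ) * N ε‖ ^ 2 = Fintype.card m * Fintype.card n :=
    fun P ε => by rw [norm_unitary_mul, hnorm]
  -- the competitor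
  set H : Matrix (m × n) (m × n) ℂ := (Complex.I / 2) • (B - Bᴴ) with hHdef
  have hH : H.IsHermitian := by
    rw [IsHermitian, hHdef, conjTranspose_smul, conjTranspose_sub, conjTranspose_conjTranspose]
    simp only [star_div₀, RCLike.star_def, Complex.conj_I, Complex.conj_ofNat]
    module
  set C : ℝ → unitaryGroup (m × n) ℂ := fun ε => ⟨expI H ε, expI_mem_unitaryGroup hH ε⟩ with hC
  have hIH : Complex.I • H = -(1 / 2 : ℂ) • (B - Bᴴ) := by
    rw [hHdef, smul_smul]
    congr 1
    linear_combination Complex.I_mul_I / 2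
  have hCexp := expI_expansion H
  rw [hIH] at hCexp
  have hCN : (fun ε : ℝ => (C ε : Matrix (m × n) (m × n) ℂ) * N ε - 1 -
      (ε : ℂ) • ((1 / 2 : ℂ) • (B + Bᴴ))) =o[𝓝[≠] 0] (fun ε : ℝ => ε) := by
    refine (expansion_mul hCexp hN).congr_left fun ε => ?_
    change expI H ε * N ε - 1 - _ = expI H ε * N ε - 1 - _
    module
  have hCas := choiInfo_asymptotics hCN fun ε => hPn _ ε
  choose q hq0 hq1 hlo hhi hKL hmin using
    fun ε => exists_spectral_defect ((P ε : Matrix (m × n) (m × n) ℂ) * N ε) (hPn _ ε)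
  set κ := ‖tracelessProj m n ((1 / 2 : ℂ) • (B + Bᴴ))‖ ^ 2 /
    (Fintype.card m * Fintype.card n) with hκ
  have hκ0 : 0 ≤ κ := by positivity
  have hq : ∀ δ > 0, ∀ᶠ ε in 𝓝[≠] 0, q ε ≤ (κ + δ) * ε ^ 2 := by
    intro δ hδ
    have hcard : (1 : ℝ) / Fintype.card (m × m) > 0 := by
      have : (0 : ℝ) < Fintype.card (m × m) := by exact_mod_cast Fintype.card_pos
      positivity
    -- The competitor `C` bounds the entropy of the maximizer from above. The `1/2` keeps `r`
    -- positive even when the dimension is one.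
    refine eventually_le_of_negMulLog_le (r := max (1 - 1 / Fintype.card (m × m)) (1 / 2))
      (g := fun ε => Real.log (Fintype.card m) - choiInfo ((C ε : Matrix (m × n) (m × n) ℂ) * N ε))
      hκ0 (lt_max_of_lt_right (by norm_num)) (max_lt (by linarith) (by norm_num))
      (fun ε => (hq1 ε).trans (le_max_left _ _)) (Eventually.of_forall fun ε => ?_) ?_ hδ
    · have h1 := hlo ε
      have h2 := hPmax ε (C ε)
      have h3 := choiInfo_le_log_card _ (hPn (P ε) ε)
      linarith
    · refine hCas.neg_left.congr_left fun ε => ?_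
      ring
  obtain ⟨U₁, U₂, hU⟩ := exists_product_gauge hN hKL hq
  have hopt : ∀ ε (P' : unitaryGroup (m × n) ℂ),
      choiInfo ((P' : Matrix (m × n) (m × n) ℂ) * N ε) ≤
      choiInfo (((kronUnitary (U₁ ε) (U₂ ε) * P ε : unitaryGroup (m × n) ℂ) :
        Matrix (m × n) (m × n) ℂ) * N ε) := by
    intro ε P'
    rw [UnitaryGroup.mul_val, Matrix.mul_assoc, choiInfo_kronUnitary_mul]
    exact hPmax ε P'
  -- The expansion concerns only `ε ≠ 0`, so the value at `0` can be reset freely.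
  refine ⟨fun ε => if ε = 0 then 1 else kronUnitary (U₁ ε) (U₂ ε) * P ε, if_pos rfl, ?_, ?_⟩
  · refine hU.congr' ?_ EventuallyEq.rfl
    filter_upwards [self_mem_nhdsWithin] with ε hε
    rw [if_neg (show ε ≠ 0 from hε)]
  · intro ε P'
    by_cases hε : ε = 0
    · subst hε
      simp only [if_true]
      rw [hN0, UnitaryGroup.one_val, Matrix.one_mul]
      refine choiInfo_le_one _ ?_
      rw [norm_unitary_mul, norm_one_sq]
    · simp only [hε, if_false]
      exact hopt ε P'

end ChoiInfo

end MixedBulk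

namespace MixedBulk

variable {d k : ℕ}

/-! ### Reduction of the code to an operator on `A`. -/

section Reduce

/-- The coefficient matrix of `χ`. -/
def coeffMatrix (χ : Fin k × Fin k → ℂ) : Matrix (Fin k) (Fin k) ℂ := fun y z => χ (y, z)

/-- `Z`, with `Ā` as its column index. -/
def unfoldB (Z : Matrix (Idx d k) (Fin d) ℂ) : Matrix (IdxA d k × Fin d) (Fin k) ℂ :=
  fun p z => Z (p.1, z) p.2

/-- The operator `Y` on `A` with `Z |ψ⟩ = (Y ⊗ 1) |ψ⟩ |χ⟩`. -/
def reduce (χ : Fin k × Fin k → ℂ) :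
    Matrix (Idx d k) (Fin d) ℂ →ₗ[ℂ] Matrix (IdxA d k) (IdxA d k) ℂ where
  -- For flat `χ` with coefficient matrix `C`, `√k C` is unitary, so `k Cᴴ` inverts `C`.
  toFun Z := Matrix.of fun p q => ((k : ℂ) • (unfoldB Z * (coeffMatrix χ)ᴴ)) (p, q.1) q.2
  map_add' Z Z' := by
    ext p q
    have h : unfoldB (Z + Z') = unfoldB Z + unfoldB Z' := rfl
    simp [h, Matrix.add_mul, mul_add]
  map_smul' c Z := by
    ext p q
    have h : unfoldB (c • Z) = c • unfoldB Z := rfl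
    simp [h, mul_left_comm]

theorem reduce_apply (χ : Fin k × Fin k → ℂ) (Z : Matrix (Idx d k) (Fin d) ℂ) (p q : IdxA d k) :
    reduce χ Z p q = ((k : ℂ) • (unfoldB Z * (coeffMatrix χ)ᴴ)) (p, q.1) q.2 := rfl

variable {χ : Fin k × Fin k → ℂ}

/-- `χ` has a flat entanglement spectrum. -/
def IsFlat (χ : Fin k × Fin k → ℂ) : Prop :=
  trRight (Matrix.vecMulVec χ (star χ)) = (1 / k : ℂ) • (1 : Matrix (Fin k) (Fin k) ℂ)

variable [NeZero d] [NeZero k]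

theorem natCast_ne_zero_of_neZero (l : ℕ) [NeZero l] : (l : ℂ) ≠ 0 :=
  Nat.cast_ne_zero.2 (NeZero.ne l)

theorem IsFlat.mul_conjTranspose (hχ : IsFlat χ) :
    (k : ℂ) • (coeffMatrix χ * (coeffMatrix χ)ᴴ) = 1 := by
  have h : coeffMatrix χ * (coeffMatrix χ)ᴴ = (1 / k : ℂ) • 1 := by
    rw [← hχ]
    ext y y'
    simp [coeffMatrix, mul_apply, trRight, vecMulVec]
  rw [h, smul_smul, mul_one_div_cancel (natCast_ne_zero_of_neZero k), one_smul]

theorem IsFlat.conjTranspose_mul (hχ : IsFlat χ) :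
    (k : ℂ) • ((coeffMatrix χ)ᴴ * coeffMatrix χ) = 1 := by
  have h := hχ.mul_conjTranspose
  rw [← Matrix.smul_mul, mul_eq_one_comm, Matrix.mul_smul] at h
  exact h

theorem reduce_appendState (hχ : IsFlat χ) : reduce χ (appendState (d := d) χ) = 1 := by
  ext ⟨a, x⟩ ⟨b, y⟩
  have h := congrFun (congrFun hχ.mul_conjTranspose x) y
  simp only [Matrix.smul_apply, mul_apply, conjTranspose_apply, coeffMatrix] at h
  rw [reduce_apply]
  simp only [Matrix.smul_apply, mul_apply, conjTranspose_apply, unfoldB, appendState, coeffMatrix]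
  by_cases hab : a = b
  · subst hab
    simp only [if_true]
    rw [h]
    simp [one_apply, Prod.ext_iff]
  · simp [hab, one_apply, Prod.ext_iff]

theorem reduce_kronecker_one_mul (P : Matrix (IdxA d k) (IdxA d k) ℂ)
    (Z : Matrix (Idx d k) (Fin d) ℂ) :
    reduce χ ((P ⊗ₖ (1 : Matrix (Fin k) (Fin k) ℂ)) * Z) = P * reduce χ Z := by
  ext p q
  simp only [reduce_apply, Matrix.smul_apply, smul_eq_mul, mul_apply, unfoldB, kroneckerMap_apply,
    conjTranspose_apply, Fintype.sum_prod_type (α₁ := IdxA d k), one_apply, mul_ite, mul_one,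
    mul_zero, ite_mul, zero_mul, Finset.sum_ite_eq, Finset.mem_univ, if_true, Finset.sum_mul,
    Finset.mul_sum]
  rw [Finset.sum_comm]
  exact Finset.sum_congr rfl fun _ _ => Finset.sum_congr rfl fun _ _ => by ring

/-- The operator on `A₂` that acts on `χ` as `Q` does on `Ā`. -/
noncomputable def transfer (χ : Fin k × Fin k → ℂ) (Q : Matrix (Fin k) (Fin k) ℂ) :
    Matrix (Fin k) (Fin k) ℂ :=
  (k : ℂ) • (coeffMatrix χ * Qᵀ * (coeffMatrix χ)ᴴ)

/-- An operator on `Ā` can be moved through the maximally entangled `χ` onto `A₂`. There it acts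
before `Y`, hence on the right. -/
theorem reduce_one_kronecker_mul (hχ : IsFlat χ) (Q : Matrix (Fin k) (Fin k) ℂ)
    (Z : Matrix (Idx d k) (Fin d) ℂ) :
    reduce χ (((1 : Matrix (IdxA d k) (IdxA d k) ℂ) ⊗ₖ Q) * Z) =
      reduce χ Z * ((1 : Matrix (Fin d) (Fin d) ℂ) ⊗ₖ transfer χ Q) := by
  have h1 : unfoldB (((1 : Matrix (IdxA d k) (IdxA d k) ℂ) ⊗ₖ Q) * Z) = unfoldB Z * Qᵀ := by
    ext p z
    simp only [unfoldB, mul_apply, kroneckerMap_apply, Fintype.sum_prod_type (α₁ := IdxA d k),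
      one_apply, ite_mul, one_mul, zero_mul, transpose_apply]
    rw [Finset.sum_comm]
    simp [mul_comm]
  have h2 : (k : ℂ) • (unfoldB Z * Qᵀ * (coeffMatrix χ)ᴴ) =
      (k : ℂ) • (unfoldB Z * (coeffMatrix χ)ᴴ) * transfer χ Q := by
    have h := hχ.conjTranspose_mul
    calc _ = (k : ℂ) • (unfoldB Z * ((k : ℂ) • ((coeffMatrix χ)ᴴ * coeffMatrix χ)) * Qᵀ *
          (coeffMatrix χ)ᴴ) := by rw [h, Matrix.mul_one]
      _ = _ := by
        rw [transfer]
        simp only [Matrix.mul_smul, Matrix.smul_mul, Matrix.mul_assoc]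
  ext p q
  rw [reduce_apply, h1, h2, mul_apply, mul_apply, Fintype.sum_prod_type]
  simp [reduce_apply, kroneckerMap_apply, one_apply]

theorem transfer_mem_unitaryGroup (hχ : IsFlat χ) (Q : RecB k) :
    transfer χ (Q : Matrix (Fin k) (Fin k) ℂ) ∈ unitaryGroup (Fin k) ℂ := by
  have hQ : (Q : Matrix (Fin k) (Fin k) ℂ)ᵀ * ((Q : Matrix (Fin k) (Fin k) ℂ)ᵀ)ᴴ = 1 := by
    change (Q : Matrix (Fin k) (Fin k) ℂ)ᵀ * ((Q : Matrix (Fin k) (Fin k) ℂ)ᴴ)ᵀ = 1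
    rw [← transpose_mul, ← star_eq_conjTranspose, UnitaryGroup.star_mul_self, transpose_one]
  rw [mem_unitaryGroup_iff, transfer, star_eq_conjTranspose, conjTranspose_smul, conjTranspose_mul,
    conjTranspose_mul, conjTranspose_conjTranspose, star_natCast]
  set C := coeffMatrix χ
  set q := (Q : Matrix (Fin k) (Fin k) ℂ)ᵀ
  calc (k : ℂ) • (C * q * Cᴴ) * (k : ℂ) • (C * (qᴴ * Cᴴ))
      = (k : ℂ) • (C * (q * ((k : ℂ) • (Cᴴ * C)) * qᴴ) * Cᴴ) := by
        simp only [Matrix.mul_smul, Matrix.smul_mul, Matrix.mul_assoc]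
    _ = 1 := by
        rw [hχ.conjTranspose_mul, Matrix.mul_one, hQ, Matrix.mul_one, hχ.mul_conjTranspose]

theorem transfer_conjTranspose (Q : Matrix (Fin k) (Fin k) ℂ) :
    (transfer χ Q)ᴴ = transfer χ Qᴴ := by
  rw [transfer, transfer, conjTranspose_smul, conjTranspose_mul, conjTranspose_mul,
    conjTranspose_conjTranspose, star_natCast, Matrix.mul_assoc]
  rfl

/-- `reduce χ Z` and `√k Z` have the same Gram matrices. -/
theorem reduce_mul_conjTranspose (hχ : IsFlat χ) (Z : Matrix (Idx d k) (Fin d) ℂ)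
    (p p' : IdxA d k) (j j' : Fin d) :
    ∑ y, reduce χ Z p (j, y) * star (reduce χ Z p' (j', y)) =
      (k : ℂ) * ∑ z, Z (p, z) j * star (Z (p', z) j') := by
  have h : ((k : ℂ) • (unfoldB Z * (coeffMatrix χ)ᴴ)) * ((k : ℂ) • (unfoldB Z * (coeffMatrix χ)ᴴ))ᴴ
      = (k : ℂ) • (unfoldB Z * (unfoldB Z)ᴴ) := by
    rw [conjTranspose_smul, conjTranspose_mul, conjTranspose_conjTranspose, star_natCast]
    calc _ = (k : ℂ) • (unfoldB Z * ((k : ℂ) • ((coeffMatrix χ)ᴴ * coeffMatrix χ)) *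
          (unfoldB Z)ᴴ) := by simp only [Matrix.mul_smul, Matrix.smul_mul, Matrix.mul_assoc]
      _ = _ := by rw [hχ.conjTranspose_mul, Matrix.mul_one]
  have h2 := congrFun (congrFun h (p, j)) (p', j')
  rw [mul_apply, Matrix.smul_apply, mul_apply, smul_eq_mul] at h2
  exact h2

/-- Tracing out `Ā` sees only Gram matrices, which `reduce` preserves up to the factor `k`; that
factor turns `1/d` into `1/(d k)`. -/
theorem extendRef_recoveredChannel (hχ : IsFlat χ) (V : Matrix (Idx d k) (Fin d) ℂ)
    (RA : RecA d k) (RB : RecB k) :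
    extendRef (recoveredChannel V RA RB) (maxEntangled d) =
      choiState (reduce χ (recovery RA RB * V)) := by
  have hk : (k : ℂ) ≠ 0 := natCast_ne_zero_of_neZero k
  ext ⟨a, j⟩ ⟨a', j'⟩
  set Z := recovery RA RB * V with hZ
  have h1 : ∀ σ, recoveredChannel V RA RB σ = trRight (trRight (Z * σ * Zᴴ)) := by
    intro σ
    rw [recoveredChannel, hZ, conjTranspose_mul]
    simp only [Matrix.mul_assoc]
  have h2 : ∀ p q : Idx d k, (Z * Matrix.of (fun l l' => maxEntangled d (l, j) (l', j')) * Zᴴ) p q = (1 / d : ℂ) * (Z p j * star (Z q j')) := by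
    intro p q
    simp only [mul_apply, Matrix.of_apply, maxEntangled, conjTranspose_apply, Finset.sum_mul]
    rw [Finset.sum_eq_single j', Finset.sum_eq_single j]
    · simp; ring
    · intro l _ hl; simp [hl]
    · simp
    · intro l _ hl; simp [hl]
    · simp
  change recoveredChannel V RA RB (Matrix.of fun l l' => maxEntangled d (l, j) (l', j')) a a' = _
  rw [h1]
  simp only [trRight, h2]
  simp only [choiState, Matrix.smul_apply, mul_apply, conjTranspose_apply, realign,
    Fintype.sum_prod_type, reduce_mul_conjTranspose hχ, Fintype.card_fin, smul_eq_mul,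
    ← Finset.mul_sum]
  field_simp

theorem Ic_eq_choiInfo (hχ : IsFlat χ) (V : Matrix (Idx d k) (Fin d) ℂ)
    (RA : RecA d k) (RB : RecB k) :
    Ic V RA RB = choiInfo (reduce χ (recovery RA RB * V)) := by
  rw [Ic, coherentInfo, extendRef_recoveredChannel hχ, choiInfo]

open scoped Matrix.Norms.Frobenius in
theorem norm_reduce_sq (hχ : IsFlat χ) (Z : Matrix (Idx d k) (Fin d) ℂ) :
    ‖reduce χ Z‖ ^ 2 = k * ‖Z‖ ^ 2 := by
  have key : ∀ p j, ∑ y, ‖reduce χ Z p (j, y)‖ ^ 2 = k * ∑ z, ‖Z (p, z) j‖ ^ 2 := by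
    intro p j
    have h := reduce_mul_conjTranspose hχ Z p p j j
    have hn : ∀ w : ℂ, w * star w = ((‖w‖ ^ 2 : ℝ) : ℂ) := fun w => by
      rw [Complex.ofReal_pow]; exact Complex.mul_conj' w
    simp only [hn] at h
    exact_mod_cast h
  simp only [frobenius_sq, Fintype.sum_prod_type (α₁ := IdxA d k)]
  rw [Finset.mul_sum]
  refine Finset.sum_congr rfl fun p _ => ?_
  rw [Fintype.sum_prod_type]
  simp only [key, ← Finset.mul_sum]
  rw [Finset.sum_comm]

open scoped Matrix.Norms.Frobenius in
theorem isLittleO_reduce (hχ : IsFlat χ) {f : ℝ → Matrix (Idx d k) (Fin d) ℂ} {g : ℝ → ℝ}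
    {l : Filter ℝ} (h : f =o[l] g) : (fun ε => reduce χ (f ε)) =o[l] g := by
  refine IsBigO.trans_isLittleO (IsBigO.of_bound (Real.sqrt k)
    (Eventually.of_forall fun x => ?_)) h
  refine le_of_sq_le_sq ?_ (by positivity)
  rw [norm_reduce_sq hχ, mul_pow, Real.sq_sqrt (by positivity)]

end Reduce

/-! ### The operators `J`, `D` and the coefficients `c₁`, `c₂`. -/

section Coefficients

variable {χ : Fin k × Fin k → ℂ} {WR : Matrix (Idx d k) (Idx d k) ℂ}

theorem stateProj_conjTranspose : (stateProj d χ)ᴴ = stateProj d χ := by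
  ext p q
  simp only [conjTranspose_apply, stateProj, eq_comm (a := q.1.1)]
  split_ifs <;> simp [mul_comm]

theorem smul_trRight_mul_stateProj :
    (k : ℂ) • trRight (WR * stateProj d χ) = reduce χ (WR * appendState (d := d) χ) := by
  ext p q
  simp only [Matrix.smul_apply, trRight, mul_apply, stateProj, reduce_apply, unfoldB, appendState,
    conjTranspose_apply, coeffMatrix, Finset.sum_mul]
  congr 1
  refine Finset.sum_congr rfl fun z _ => Finset.sum_congr rfl fun r _ => ?_
  split_ifs <;> ring

theorem smul_trRight_stateProj_mul (hW : WR.IsHermitian) :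
    (k : ℂ) • trRight (stateProj d χ * WR) = (reduce χ (WR * appendState (d := d) χ))ᴴ := by
  rw [← smul_trRight_mul_stateProj, conjTranspose_smul, ← trRight_conjTranspose, conjTranspose_mul,
    stateProj_conjTranspose, hW.eq, star_natCast]

theorem opJ_eq (hW : WR.IsHermitian) :
    opJ χ WR = reduce χ (WR * appendState (d := d) χ) + (reduce χ (WR * appendState (d := d) χ))ᴴ := by
  rw [opJ, trRight_add, smul_add, smul_trRight_mul_stateProj, smul_trRight_stateProj_mul hW]

theorem opD_eq (hW : WR.IsHermitian) :
    opD χ WR = Complex.I • (reduce χ (WR * appendState (d := d) χ) - (reduce χ (WR * appendState (d := d) χ))ᴴ) := by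
  rw [opD, sub_eq_add_neg, ← neg_one_smul ℂ (stateProj d χ * WR), trRight_add, trRight_smul,
    mul_smul, smul_add, smul_comm _ (-1 : ℂ), smul_trRight_mul_stateProj,
    smul_trRight_stateProj_mul hW, neg_one_smul, ← sub_eq_add_neg]

theorem opJ_isHermitian (hW : WR.IsHermitian) : (opJ χ WR).IsHermitian := by
  rw [opJ_eq hW, IsHermitian, conjTranspose_add, conjTranspose_conjTranspose, add_comm]

theorem opD_isHermitian (hW : WR.IsHermitian) : (opD χ WR).IsHermitian := by
  rw [opD_eq hW, IsHermitian, conjTranspose_smul, conjTranspose_sub, conjTranspose_conjTranspose]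
  simp only [RCLike.star_def, Complex.conj_I]
  module

theorem trRight_reduce (Z : Matrix (Idx d k) (Fin d) ℂ) :
    trRight (reduce χ Z) = (k : ℂ) • ((appendState χ : Matrix (Idx d k) (Fin d) ℂ)ᴴ * Z) := by
  ext a b
  simp only [trRight, reduce_apply, Matrix.smul_apply, mul_apply, unfoldB, conjTranspose_apply,
    coeffMatrix, appendState, ← Finset.smul_sum, Fintype.sum_prod_type]
  congr 1
  rw [Finset.sum_eq_single a]
  · simp [mul_comm]
  · intro c _ hc; simp [hc]
  · simp

/-- The trace over `A₂` of the reduced operator is `k` times the compression of the Hermitian `W_R`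
by `χ`, so it is Hermitian and cancels in `D`. This is why `c₂` has fewer terms than `c₁`. -/
theorem trRight_opD (hW : WR.IsHermitian) : trRight (opD χ WR) = 0 := by
  have h : (trRight (reduce χ (WR * appendState (d := d) χ)))ᴴ = trRight (reduce χ (WR * appendState (d := d) χ)) := by
    rw [trRight_reduce, conjTranspose_smul, conjTranspose_mul, conjTranspose_mul, hW.eq,
      conjTranspose_conjTranspose, star_natCast, Matrix.mul_assoc]
  rw [opD_eq hW, trRight_smul, sub_eq_add_neg, ← neg_one_smul ℂ (_ᴴ), trRight_add, trRight_smul,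
    trRight_conjTranspose, h, neg_one_smul, add_neg_cancel, smul_zero]

variable [NeZero d] [NeZero k]

open scoped Matrix.Norms.Frobenius

theorem c₁_eq (hW : WR.IsHermitian) : c₁ χ WR = (d : ℝ) / (2 * k * ((d : ℝ) ^ 2 - 1)) *
    ‖tracelessProj (Fin d) (Fin k) (opJ χ WR)‖ ^ 2 := by
  have h := opJ_isHermitian (χ := χ) hW
  rw [c₁, norm_tracelessProj_sq, h.eq, ← trLeft_conjTranspose, ← trRight_conjTranspose,
    ← trace_conjTranspose, h.eq, Fintype.card_fin, Fintype.card_fin]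
  simp only [pow_two]

theorem c₂_eq (hW : WR.IsHermitian) : c₂ χ WR = (d : ℝ) / (2 * k * ((d : ℝ) ^ 2 - 1)) *
    ‖tracelessProj (Fin d) (Fin k) (opD χ WR)‖ ^ 2 := by
  have h := opD_isHermitian (χ := χ) hW
  have h0 := trRight_opD (χ := χ) hW
  have h1 : (opD χ WR).trace = 0 := by rw [← trace_trRight, h0, trace_zero]
  rw [c₂, norm_tracelessProj_sq, h.eq, ← trLeft_conjTranspose, h0, h1, h.eq, Fintype.card_fin,
    Fintype.card_fin]
  simp [pow_two]

/-- `D/2` and `iJ/2` are the Hermitian and anti-Hermitian parts of the generator, and the projection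
commutes with the adjoint. -/
theorem norm_tracelessProj_generator_sq (hW : WR.IsHermitian) :
    ‖tracelessProj (Fin d) (Fin k) (Complex.I • reduce χ (WR * appendState (d := d) χ))‖ ^ 2 =
      (‖tracelessProj (Fin d) (Fin k) (opJ χ WR)‖ ^ 2 +
        ‖tracelessProj (Fin d) (Fin k) (opD χ WR)‖ ^ 2) / 4 := by
  have hJ := opJ_isHermitian (χ := χ) hW
  have hD := opD_isHermitian (χ := χ) hW
  set M := reduce χ (WR * appendState (d := d) χ)
  have hM : Complex.I • M = (1 / 2 : ℂ) • opD χ WR + (Complex.I / 2) • opJ χ WR := by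
    rw [opD_eq hW, opJ_eq hW]
    module
  have e1 : ‖(1 / 2 : ℂ)‖ = 1 / 2 := by simp
  have e2 : ‖(Complex.I / 2 : ℂ)‖ = 1 / 2 := by simp
  rw [hM, map_add, map_smul, map_smul, norm_sq_hermitian_add, norm_smul, norm_smul, e1, e2]
  · ring
  · rw [conjTranspose_smul, ← tracelessProj_conjTranspose, hD.eq]
    simp
  · rw [conjTranspose_smul, ← tracelessProj_conjTranspose, hJ.eq, ← neg_smul]
    congr 1
    simp [neg_div]

end Coefficients

end MixedBulk

namespace MixedBulk

/-! ### First-order expansions of matrix families. -/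

section Expansions

open scoped Matrix.Norms.Frobenius

variable {m n : Type*} [Fintype m] [DecidableEq m] [Fintype n] [DecidableEq n]

theorem hasDerivAt_entries_iff {F : ℝ → Matrix m m ℂ} {A : Matrix m m ℂ} (h0 : F 0 = 1) :
    (∀ p q, HasDerivAt (fun ε => F ε p q) (A p q) 0) ↔
      (fun ε : ℝ => F ε - 1 - (ε : ℂ) • A) =o[𝓝[≠] 0] (fun ε : ℝ => ε) := by
  rw [isLittleO_matrix]
  refine forall_congr' fun p => forall_congr' fun q => ?_
  have hins : (𝓝 (0 : ℝ)) = 𝓝[insert 0 {0}ᶜ] 0 := by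
    rw [Set.insert_eq, Set.union_compl_self, nhdsWithin_univ]
  rw [hasDerivAt_iff_isLittleO, hins, isLittleO_insert (by simp)]
  simp only [h0, sub_zero, Matrix.sub_apply, Matrix.smul_apply, Complex.real_smul, smul_eq_mul]

theorem expansion_conjTranspose {F : ℝ → Matrix m m ℂ} {A : Matrix m m ℂ}
    (hF : (fun ε : ℝ => F ε - 1 - (ε : ℂ) • A) =o[𝓝[≠] 0] (fun ε : ℝ => ε)) :
    (fun ε : ℝ => (F ε)ᴴ - 1 - (ε : ℂ) • Aᴴ) =o[𝓝[≠] 0] (fun ε : ℝ => ε) := by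
  refine (isLittleO_conjTranspose hF).congr_left fun ε => ?_
  simp

theorem expansion_kronecker_one {F : ℝ → Matrix m m ℂ} {A : Matrix m m ℂ}
    (hF : (fun ε : ℝ => F ε - 1 - (ε : ℂ) • A) =o[𝓝[≠] 0] (fun ε : ℝ => ε)) :
    (fun ε : ℝ => F ε ⊗ₖ (1 : Matrix n n ℂ) - 1 - (ε : ℂ) • (A ⊗ₖ (1 : Matrix n n ℂ)))
      =o[𝓝[≠] 0] (fun ε : ℝ => ε) := by
  refine IsBigO.trans_isLittleO (IsBigO.of_bound ‖(1 : Matrix n n ℂ)‖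
    (Eventually.of_forall fun ε => ?_)) hF
  have : F ε ⊗ₖ (1 : Matrix n n ℂ) - 1 - (ε : ℂ) • (A ⊗ₖ (1 : Matrix n n ℂ)) =
      (F ε - 1 - (ε : ℂ) • A) ⊗ₖ (1 : Matrix n n ℂ) := by
    have h1 : (1 : Matrix (m × n) (m × n) ℂ) = (1 : Matrix m m ℂ) ⊗ₖ (1 : Matrix n n ℂ) :=
      one_kronecker_one.symm
    rw [h1, ← smul_kronecker]
    ext p q
    simp only [Matrix.sub_apply, kroneckerMap_apply, sub_mul]
  rw [this, norm_kronecker, mul_comm]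

theorem expansion_unitary_conj (U : unitaryGroup m ℂ) {F : ℝ → Matrix m m ℂ} {A : Matrix m m ℂ}
    (hF : (fun ε : ℝ => F ε - 1 - (ε : ℂ) • A) =o[𝓝[≠] 0] (fun ε : ℝ => ε)) :
    (fun ε : ℝ => (U : Matrix m m ℂ) * F ε * (U : Matrix m m ℂ)ᴴ - 1 -
      (ε : ℂ) • ((U : Matrix m m ℂ) * A * (U : Matrix m m ℂ)ᴴ)) =o[𝓝[≠] 0] (fun ε : ℝ => ε) := by
  refine IsBigO.trans_isLittleO (IsBigO.of_bound ‖(U : Matrix m m ℂ)ᴴ‖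
    (Eventually.of_forall fun ε => ?_)) hF
  have hU : (U : Matrix m m ℂ) * (U : Matrix m m ℂ)ᴴ = 1 := mem_unitaryGroup_iff.1 U.2
  have : (U : Matrix m m ℂ) * F ε * (U : Matrix m m ℂ)ᴴ - 1 -
      (ε : ℂ) • ((U : Matrix m m ℂ) * A * (U : Matrix m m ℂ)ᴴ) =
      (U : Matrix m m ℂ) * (F ε - 1 - (ε : ℂ) • A) * (U : Matrix m m ℂ)ᴴ := by
    rw [Matrix.mul_sub, Matrix.mul_sub, Matrix.sub_mul, Matrix.sub_mul, Matrix.mul_one, hU,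
      Matrix.mul_smul, Matrix.smul_mul]
  rw [this, mul_comm]
  exact (frobenius_norm_mul _ _).trans (by rw [norm_unitary_mul])

end Expansions

/-! ### Recovery families of a skewed code. -/

variable {d k : ℕ} {V : ℝ → Matrix (Idx d k) (Fin d) ℂ} {W WR : Matrix (Idx d k) (Idx d k) ℂ}
  {χ : Fin k × Fin k → ℂ} {RA₀ : RecA d k} {RB₀ : RecB k} {RA : ℝ → RecA d k} {RB : ℝ → RecB k}

theorem recovery_conjTranspose_mul (RA : RecA d k) (RB : RecB k) :
    (recovery RA RB)ᴴ * recovery RA RB = 1 :=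
  UnitaryGroup.star_mul_self (kronUnitary RA RB)

theorem recovery_mul_conjTranspose (RA : RecA d k) (RB : RecB k) :
    recovery RA RB * (recovery RA RB)ᴴ = 1 :=
  mem_unitaryGroup_iff.1 (kronUnitary RA RB).2

theorem IsSkewedCode.recovery_mul (hV : IsSkewedCode V W χ RA₀ RB₀) (RA : RecA d k) (RB : RecB k)
    (ε : ℝ) : recovery RA RB * V ε =
      (recovery RA RB * expI W ε * (recovery RA₀ RB₀)ᴴ) * appendState (d := d) χ := by
  rw [hV.skewed ε, ← hV.exact_recovery, Matrix.mul_assoc _ (recovery RA₀ RB₀)ᴴ,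
    ← Matrix.mul_assoc (recovery RA₀ RB₀)ᴴ, recovery_conjTranspose_mul, Matrix.one_mul,
    Matrix.mul_assoc]

theorem IsRecoveryFamily.at_zero (hR : IsRecoveryFamily W RA₀ RB₀ RA RB WR) :
    recovery (RA 0) (RB 0) * expI W 0 * (recovery RA₀ RB₀)ᴴ = 1 := by
  rw [hR.start_A, hR.start_B, expI_zero, Matrix.mul_one, recovery_mul_conjTranspose]

open scoped Matrix.Norms.Frobenius in
theorem IsRecoveryFamily.expansion (hR : IsRecoveryFamily W RA₀ RB₀ RA RB WR) :
    (fun ε : ℝ => recovery (RA ε) (RB ε) * expI W ε * (recovery RA₀ RB₀)ᴴ - 1 -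
      (ε : ℂ) • (Complex.I • WR)) =o[𝓝[≠] 0] (fun ε : ℝ => ε) :=
  (hasDerivAt_entries_iff hR.at_zero).1 hR.generator

open scoped Matrix.Norms.Frobenius in
theorem isRecoveryFamily_of_expansion (hA : RA 0 = RA₀) (hB : RB 0 = RB₀) (hW : WR.IsHermitian)
    (h : (fun ε : ℝ => recovery (RA ε) (RB ε) * expI W ε * (recovery RA₀ RB₀)ᴴ - 1 -
      (ε : ℂ) • (Complex.I • WR)) =o[𝓝[≠] 0] (fun ε : ℝ => ε)) :
    IsRecoveryFamily W RA₀ RB₀ RA RB WR where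
  start_A := hA
  start_B := hB
  hermitian := hW
  generator := by
    refine (hasDerivAt_entries_iff (A := Complex.I • WR) ?_).2 h
    rw [hA, hB, expI_zero, Matrix.mul_one, recovery_mul_conjTranspose]

open scoped Matrix.Norms.Frobenius in
/-- The constant recovery family. -/
theorem isRecoveryFamily_const (hW : W.IsHermitian) (RA₀ : RecA d k) (RB₀ : RecB k) :
    IsRecoveryFamily W RA₀ RB₀ (fun _ => RA₀) (fun _ => RB₀)
      (recovery RA₀ RB₀ * W * (recovery RA₀ RB₀)ᴴ) := by
  refine isRecoveryFamily_of_expansion rfl rfl (isHermitian_mul_mul_conjTranspose _ hW) ?_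
  refine (expansion_unitary_conj (kronUnitary RA₀ RB₀) (expI_expansion W)).congr_left fun ε => ?_
  rw [Matrix.mul_smul, Matrix.smul_mul]
  rfl

open scoped Matrix.Norms.Frobenius in
theorem IsRecoveryFamily.left_mul (hR : IsRecoveryFamily W RA₀ RB₀ RA RB WR)
    {P : ℝ → RecA d k} {O : Matrix (IdxA d k) (IdxA d k) ℂ} (hO : O.IsHermitian) (hP0 : P 0 = 1)
    (hP : (fun ε : ℝ => (P ε : Matrix (IdxA d k) (IdxA d k) ℂ) - 1 - (ε : ℂ) • (Complex.I • O))
      =o[𝓝[≠] 0] (fun ε : ℝ => ε)) :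
    IsRecoveryFamily W RA₀ RB₀ (fun ε => P ε * RA ε) RB
      (WR + O ⊗ₖ (1 : Matrix (Fin k) (Fin k) ℂ)) := by
  refine isRecoveryFamily_of_expansion ?_ hR.start_B ?_ ?_
  · rw [hP0, one_mul, hR.start_A]
  · rw [IsHermitian, conjTranspose_add, conjTranspose_kronecker, hR.hermitian.eq, hO.eq,
      conjTranspose_one]
  · have h := expansion_mul (expansion_kronecker_one (n := Fin k) hP) hR.expansion
    refine h.congr_left fun ε => ?_
    have h1 : recovery (P ε * RA ε) (RB ε) =
        ((P ε : Matrix (IdxA d k) (IdxA d k) ℂ) ⊗ₖ (1 : Matrix (Fin k) (Fin k) ℂ)) *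
          recovery (RA ε) (RB ε) := by
      rw [recovery, recovery, ← mul_kronecker_mul, Matrix.one_mul]
      rfl
    rw [h1, smul_kronecker, ← smul_add Complex.I,
      add_comm (O ⊗ₖ (1 : Matrix (Fin k) (Fin k) ℂ)) WR]
    simp only [Matrix.mul_assoc]

variable [NeZero d] [NeZero k]

section

open scoped Matrix.Norms.Frobenius

theorem IsSkewedCode.norm_reduce_sq (hV : IsSkewedCode V W χ RA₀ RB₀) (RA : RecA d k)
    (RB : RecB k) (ε : ℝ) : ‖reduce χ (recovery RA RB * V ε)‖ ^ 2 =
      Fintype.card (Fin d) * Fintype.card (Fin k) := by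
  have h1 : ‖recovery RA RB * V ε‖ = ‖appendState (d := d) χ‖ := by
    have e1 : ‖recovery RA RB * V ε‖ = ‖V ε‖ := norm_unitary_mul (kronUnitary RA RB) _
    have e2 : ‖expI W ε * V 0‖ = ‖V 0‖ :=
      norm_unitary_mul ⟨expI W ε, expI_mem_unitaryGroup hV.hermitian ε⟩ _
    have e3 : ‖recovery RA₀ RB₀ * V 0‖ = ‖V 0‖ := norm_unitary_mul (kronUnitary RA₀ RB₀) _
    rw [e1, hV.skewed, e2, ← hV.exact_recovery, e3]
  rw [MixedBulk.norm_reduce_sq hV.flat, h1, ← MixedBulk.norm_reduce_sq hV.flat,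
    reduce_appendState hV.flat, norm_one_sq]

theorem IsSkewedCode.reduce_expansion (hV : IsSkewedCode V W χ RA₀ RB₀)
    (hR : IsRecoveryFamily W RA₀ RB₀ RA RB WR) :
    (fun ε : ℝ => reduce χ (recovery (RA ε) (RB ε) * V ε) - 1 -
      (ε : ℂ) • (Complex.I • reduce χ (WR * appendState (d := d) χ))) =o[𝓝[≠] 0]
        (fun ε : ℝ => ε) := by
  have h : (fun ε : ℝ => (recovery (RA ε) (RB ε) * expI W ε * (recovery RA₀ RB₀)ᴴ - 1 -
      (ε : ℂ) • (Complex.I • WR)) * appendState (d := d) χ) =o[𝓝[≠] 0] (fun ε : ℝ => ε) := by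
    refine IsBigO.trans_isLittleO (IsBigO.of_bound ‖appendState (d := d) χ‖
      (Eventually.of_forall fun ε => ?_)) hR.expansion
    rw [mul_comm]
    exact frobenius_norm_mul _ _
  refine (isLittleO_reduce hV.flat h).congr_left fun ε => ?_
  rw [hV.recovery_mul, Matrix.sub_mul, Matrix.sub_mul, Matrix.smul_mul, Matrix.smul_mul,
    Matrix.one_mul, map_sub, map_sub, map_smul, map_smul, reduce_appendState hV.flat]

/-- The factor `(d² - 1)/d²` converts the prefactor `d / (2k(d² - 1))` of the coefficients into `2 ·
1/(4 d k)`. -/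
theorem IsSkewedCode.Ic_asymptotics (hd : 2 ≤ d) (hV : IsSkewedCode V W χ RA₀ RB₀)
    (hR : IsRecoveryFamily W RA₀ RB₀ RA RB WR) :
    (fun ε => Ic (V ε) (RA ε) (RB ε) - Real.log d - ((d : ℝ) ^ 2 - 1) / (d : ℝ) ^ 2 *
      (c₁ χ WR + c₂ χ WR) * (ε ^ 2 * Real.log |ε|)) =o[𝓝[≠] 0]
        (fun ε : ℝ => ε ^ 2 * Real.log |ε|) := by
  have h := choiInfo_asymptotics (hV.reduce_expansion hR) fun ε => hV.norm_reduce_sq _ _ ε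
  rw [norm_tracelessProj_generator_sq hR.hermitian] at h
  refine h.congr_left fun ε => ?_
  rw [← Ic_eq_choiInfo hV.flat, c₁_eq hR.hermitian, c₂_eq hR.hermitian, Fintype.card_fin,
    Fintype.card_fin]
  have hd0 : (d : ℝ) ≠ 0 := Nat.cast_ne_zero.2 (NeZero.ne d)
  have hk0 : (k : ℝ) ≠ 0 := Nat.cast_ne_zero.2 (NeZero.ne k)
  have hd1 : (d : ℝ) ^ 2 - 1 ≠ 0 := by
    have : (2 : ℝ) ≤ d := by exact_mod_cast hd
    nlinarith
  congr 2
  field_simp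
  ring

/-- A product unitary family has a local generator. -/
theorem tracelessProj_generator_sub_eq_zero (hW : W.IsHermitian)
    (hR : IsRecoveryFamily W RA₀ RB₀ RA RB WR) :
    tracelessProj (IdxA d k) (Fin k)
      (WR - recovery RA₀ RB₀ * W * (recovery RA₀ RB₀)ᴴ) = 0 := by
  set W₀ := recovery RA₀ RB₀ * W * (recovery RA₀ RB₀)ᴴ with hW₀
  have hR₀ := isRecoveryFamily_const hW RA₀ RB₀
  have h := expansion_mul hR.expansion (expansion_conjTranspose hR₀.expansion)
  -- Comparing with the constant family cancels `e^{iεW}` and leaves a product unitary, whose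
  -- derivative must be local.
  set P : ℝ → Matrix (Idx d k) (Idx d k) ℂ := fun ε =>
    recovery (RA ε) (RB ε) * expI W ε * (recovery RA₀ RB₀)ᴴ *
      (recovery RA₀ RB₀ * expI W ε * (recovery RA₀ RB₀)ᴴ)ᴴ with hP
  have hPk : ∀ ε, P ε = recovery (RA ε) (RB ε) * (recovery RA₀ RB₀)ᴴ := by
    intro ε
    have hE : expI W ε * (expI W ε)ᴴ = 1 := mem_unitaryGroup_iff.1 (expI_mem_unitaryGroup hW ε)
    simp only [hP, conjTranspose_mul, conjTranspose_conjTranspose]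
    calc _ = recovery (RA ε) (RB ε) * (expI W ε * ((recovery RA₀ RB₀)ᴴ * recovery RA₀ RB₀) *
          (expI W ε)ᴴ) * (recovery RA₀ RB₀)ᴴ := by simp only [Matrix.mul_assoc]
      _ = _ := by rw [recovery_conjTranspose_mul, Matrix.mul_one, hE, Matrix.mul_one]
  have hPd : ∀ ε, prodDefect (P ε) = 0 := by
    intro ε
    rw [hPk, recovery, recovery, conjTranspose_kronecker, ← mul_kronecker_mul]
    exact prodDefect_kronecker _ _
  have h1 := tracelessProj_product_isLittleO (Eventually.of_forall hPd)
    (isBigO_of_sub_smul_isLittleO h)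
  have h2 := isLittleO_tracelessProj h
  have h3 : (fun ε : ℝ => (0 : Matrix (Idx d k) (Idx d k) ℂ) - (ε : ℂ) •
      tracelessProj (IdxA d k) (Fin k) (Complex.I • (WR - W₀))) =o[𝓝[≠] 0] (fun ε : ℝ => ε) := by
    refine (h2.sub h1).congr_left fun ε => ?_
    have : Complex.I • WR + (Complex.I • W₀)ᴴ = Complex.I • (WR - W₀) := by
      rw [conjTranspose_smul, hR₀.hermitian.eq]
      simp only [RCLike.star_def, Complex.conj_I]
      module
    rw [this, map_sub (tracelessProj (IdxA d k) (Fin k)) (P ε - 1),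
      (tracelessProj (IdxA d k) (Fin k)).map_smul (ε : ℂ)]
    abel
  have h4 := tendsto_norm_div_of_isLittleO h3
  simp only [norm_zero, zero_div] at h4
  have h5 := tendsto_nhds_unique h4 tendsto_const_nhds
  rw [norm_eq_zero, map_smul, smul_eq_zero] at h5
  exact h5.resolve_left Complex.I_ne_zero

end

/-- `T` is a sum of local Hermitian terms. The `A` part reduces to itself, the `Ā` part transfers to
a Hermitian operator on `A₂`. Hence local generators change `J` but not `D`. -/
theorem reduce_local_isHermitian (hχ : IsFlat χ) {T : Matrix (Idx d k) (Idx d k) ℂ}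
    (hT : T.IsHermitian) (h0 : tracelessProj (IdxA d k) (Fin k) T = 0) :
    (reduce χ (T * appendState (d := d) χ)).IsHermitian := by
  have hL : (trLeft T)ᴴ = trLeft T := by rw [← trLeft_conjTranspose, hT.eq]
  have hRt : (trRight T)ᴴ = trRight T := by rw [← trRight_conjTranspose, hT.eq]
  have ht : star T.trace = T.trace := by rw [← trace_conjTranspose, hT.eq]
  have hdec : T = (1 / Fintype.card (IdxA d k) : ℂ) •
        ((1 : Matrix (IdxA d k) (IdxA d k) ℂ) ⊗ₖ trLeft T)
      + (1 / Fintype.card (Fin k) : ℂ) • (trRight T ⊗ₖ (1 : Matrix (Fin k) (Fin k) ℂ))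
      - (T.trace / (Fintype.card (IdxA d k) * Fintype.card (Fin k))) • 1 := by
    rw [tracelessProj_apply] at h0
    conv_lhs => rw [← sub_zero T, ← h0]
    abel
  rw [hdec, Matrix.sub_mul, Matrix.add_mul, Matrix.smul_mul, Matrix.smul_mul, Matrix.smul_mul,
    map_sub, map_add, map_smul, map_smul, map_smul, reduce_one_kronecker_mul hχ,
    reduce_kronecker_one_mul, Matrix.one_mul, reduce_appendState hχ, Matrix.one_mul,
    Matrix.mul_one, IsHermitian]
  simp only [conjTranspose_sub, conjTranspose_add, conjTranspose_smul, conjTranspose_kronecker,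
    conjTranspose_one, transfer_conjTranspose, hL, hRt, star_div₀, star_mul', ht, star_natCast,
    star_one]

theorem IsSkewedCode.opD_eq_const (hV : IsSkewedCode V W χ RA₀ RB₀)
    (hR : IsRecoveryFamily W RA₀ RB₀ RA RB WR) :
    opD χ WR = opD χ (recovery RA₀ RB₀ * W * (recovery RA₀ RB₀)ᴴ) := by
  have hR₀ := isRecoveryFamily_const hV.hermitian RA₀ RB₀
  set W₀ := recovery RA₀ RB₀ * W * (recovery RA₀ RB₀)ᴴ with hW₀
  have hT : (WR - W₀).IsHermitian := hR.hermitian.sub hR₀.hermitian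
  have h := reduce_local_isHermitian hV.flat hT
    (tracelessProj_generator_sub_eq_zero hV.hermitian hR)
  have h2 : WR = W₀ + (WR - W₀) := by abel
  rw [opD_eq hR.hermitian, opD_eq hR₀.hermitian]
  congr 1
  conv_lhs => rw [h2]
  rw [Matrix.add_mul, map_add, conjTranspose_add, h.eq]
  abel

theorem IsSkewedCode.c₂_eq_const (hV : IsSkewedCode V W χ RA₀ RB₀)
    (hR : IsRecoveryFamily W RA₀ RB₀ RA RB WR) :
    c₂ χ WR = c₂ χ (recovery RA₀ RB₀ * W * (recovery RA₀ RB₀)ᴴ) := by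
  rw [c₂, c₂, hV.opD_eq_const hR]

theorem reduce_add_kronecker_one (hχ : IsFlat χ) (O : Matrix (IdxA d k) (IdxA d k) ℂ) :
    reduce χ ((WR + O ⊗ₖ (1 : Matrix (Fin k) (Fin k) ℂ)) * appendState (d := d) χ) =
      reduce χ (WR * appendState (d := d) χ) + O := by
  rw [Matrix.add_mul, map_add, reduce_kronecker_one_mul, reduce_appendState hχ, Matrix.mul_one]

open scoped Matrix.Norms.Frobenius in
/-- Cancelling `J` by a local Hermitian operator on `A`. -/
theorem c₁_add_kronecker_one_eq_zero (hχ : IsFlat χ) (hW : WR.IsHermitian) :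
    c₁ χ (WR + (-(1 / 2 : ℂ) • opJ χ WR) ⊗ₖ (1 : Matrix (Fin k) (Fin k) ℂ)) = 0 := by
  have hJ := opJ_isHermitian (χ := χ) hW
  have hH : (WR + (-(1 / 2 : ℂ) • opJ χ WR) ⊗ₖ (1 : Matrix (Fin k) (Fin k) ℂ)).IsHermitian := by
    rw [IsHermitian, conjTranspose_add, conjTranspose_kronecker, hW.eq, conjTranspose_smul, hJ.eq,
      conjTranspose_one]
    simp
  have h0 : opJ χ (WR + (-(1 / 2 : ℂ) • opJ χ WR) ⊗ₖ (1 : Matrix (Fin k) (Fin k) ℂ)) = 0 := by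
    -- Adding `O` to the reduced operator adds `2O` to `J`, whence `O = -J/2`.
    rw [opJ_eq hH, reduce_add_kronecker_one hχ, conjTranspose_add, conjTranspose_smul, hJ.eq]
    rw [opJ_eq hW]
    simp only [star_neg, star_div₀, star_one, star_ofNat]
    module
  rw [c₁_eq hH, h0, map_zero, norm_zero]
  simp

theorem neg_half_opJ_isHermitian (hW : WR.IsHermitian) :
    (-(1 / 2 : ℂ) • opJ χ WR).IsHermitian := by
  rw [IsHermitian, conjTranspose_smul, (opJ_isHermitian hW).eq]
  simp

/-- Only the recovery on `A` is varied. An optimum over unitaries on `A` is an optimum over all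
pairs, and its first-order term is the `-J/2` that cancels `c₁`. -/
theorem IsSkewedCode.exists_optimal_recovery (hV : IsSkewedCode V W χ RA₀ RB₀) :
    ∃ (RA : ℝ → RecA d k) (RB : ℝ → RecB k) (WR : Matrix (Idx d k) (Idx d k) ℂ),
      IsRecoveryFamily W RA₀ RB₀ RA RB WR ∧ (∀ ε, IsOptimal (V ε) (RA ε) (RB ε)) ∧
      c₁ χ WR = 0 := by
  have hR₀ := isRecoveryFamily_const hV.hermitian RA₀ RB₀
  set W₀ := recovery RA₀ RB₀ * W * (recovery RA₀ RB₀)ᴴ with hW₀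
  have hN0 : reduce χ (recovery RA₀ RB₀ * V 0) = 1 := by
    rw [hV.exact_recovery, reduce_appendState hV.flat]
  obtain ⟨P, hP0, hP, hmax⟩ := exists_optimal_unitary_family (hV.reduce_expansion hR₀) hN0
    fun ε => hV.norm_reduce_sq RA₀ RB₀ ε
  set O := -(1 / 2 : ℂ) • opJ χ W₀ with hO
  have hOh : O.IsHermitian := neg_half_opJ_isHermitian hR₀.hermitian
  have hB : -(1 / 2 : ℂ) • (Complex.I • reduce χ (W₀ * appendState (d := d) χ) -
      (Complex.I • reduce χ (W₀ * appendState (d := d) χ))ᴴ) = Complex.I • O := by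
    rw [hO, opJ_eq hR₀.hermitian, conjTranspose_smul]
    simp only [RCLike.star_def, Complex.conj_I]
    module
  rw [hB] at hP
  refine ⟨_, _, _, hR₀.left_mul hOh hP0 hP, fun ε RA' RB' => ?_,
    c₁_add_kronecker_one_eq_zero hV.flat hR₀.hermitian⟩
  have key : ∀ (P : RecA d k) (Q : RecB k), Ic (V ε) (P * RA₀) (Q * RB₀) =
      choiInfo ((P : Matrix (IdxA d k) (IdxA d k) ℂ) * reduce χ (recovery RA₀ RB₀ * V ε)) := by
    intro P Q
    have h1 : recovery (P * RA₀) (Q * RB₀) =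
        ((1 : Matrix (IdxA d k) (IdxA d k) ℂ) ⊗ₖ (Q : Matrix (Fin k) (Fin k) ℂ)) *
          (((P : Matrix (IdxA d k) (IdxA d k) ℂ) ⊗ₖ (1 : Matrix (Fin k) (Fin k) ℂ)) *
            recovery RA₀ RB₀) := by
      rw [recovery, recovery, ← mul_kronecker_mul, ← mul_kronecker_mul, Matrix.one_mul,
        Matrix.one_mul]
      rfl
    rw [Ic_eq_choiInfo hV.flat, h1, Matrix.mul_assoc, Matrix.mul_assoc,
      reduce_one_kronecker_mul hV.flat, reduce_kronecker_one_mul]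
    exact choiInfo_mul_one_kronecker ⟨_, transfer_mem_unitaryGroup hV.flat Q⟩ _
  -- Any competitor is written relative to the exact recovery, after which its `Ā` factor
  -- disappears.
  have h1 := key (RA' * RA₀⁻¹) (RB' * RB₀⁻¹)
  have h2 := key (P ε) 1
  rw [inv_mul_cancel_right, inv_mul_cancel_right] at h1
  rw [one_mul] at h2
  rw [h1, h2]
  exact hmax ε _

theorem IsOptimal.Ic_eq {V : Matrix (Idx d k) (Fin d) ℂ} {RA RA' : RecA d k} {RB RB' : RecB k}
    (h : IsOptimal V RA RB) (h' : IsOptimal V RA' RB') : Ic V RA RB = Ic V RA' RB' :=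
  le_antisymm (h' RA RB) (h RA' RB')

theorem isLittleO_const_mul_sq_mul_log_iff {a : ℝ} :
    (fun ε : ℝ => a * (ε ^ 2 * Real.log |ε|)) =o[𝓝[≠] 0] (fun ε : ℝ => ε ^ 2 * Real.log |ε|) ↔
      a = 0 := by
  refine ⟨fun h => ?_, fun h => by simp [h]⟩
  by_contra ha
  have h2 := (isLittleO_const_mul_left_iff ha).1 h
  have h3 := h2.bound (c := 1 / 2) (by norm_num)
  obtain ⟨ε, h4, h5, h6⟩ := (h3.and (eventually_log_abs_neg.and self_mem_nhdsWithin)).exists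
  have h6 : ε ≠ 0 := h6
  have : 0 < ‖ε ^ 2 * Real.log |ε|‖ := norm_pos_iff.2 (mul_ne_zero (pow_ne_zero 2 h6) h5.ne)
  linarith

end MixedBulk

/-! ### The main theorem. -/

theorem mainTheorem11 (d k : ℕ) (hd : 2 ≤ d) (hk : 1 ≤ k)
    (V : ℝ → Matrix (MixedBulk.Idx d k) (Fin d) ℂ)
    (W : Matrix (MixedBulk.Idx d k) (MixedBulk.Idx d k) ℂ)
    (χ : Fin k × Fin k → ℂ) (RA₀ : MixedBulk.RecA d k) (RB₀ : MixedBulk.RecB k)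
    (hV : MixedBulk.IsSkewedCode V W χ RA₀ RB₀) :
    -- there is a recovery family that is optimal for every ε, and its `c₁` vanishes
    (∃ (RA : ℝ → MixedBulk.RecA d k) (RB : ℝ → MixedBulk.RecB k)
        (WR : Matrix (MixedBulk.Idx d k) (MixedBulk.Idx d k) ℂ),
      MixedBulk.IsRecoveryFamily W RA₀ RB₀ RA RB WR ∧
      (∀ ε, MixedBulk.IsOptimal (V ε) (RA ε) (RB ε)) ∧
      MixedBulk.c₁ χ WR = 0) ∧
    -- a recovery family attains the maximum to leading order iff its `c₁` vanishes
    (∀ (RA RAopt : ℝ → MixedBulk.RecA d k) (RB RBopt : ℝ → MixedBulk.RecB k)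
        (WR : Matrix (MixedBulk.Idx d k) (MixedBulk.Idx d k) ℂ),
      MixedBulk.IsRecoveryFamily W RA₀ RB₀ RA RB WR →
      (∀ ε, MixedBulk.IsOptimal (V ε) (RAopt ε) (RBopt ε)) →
      ((fun ε => MixedBulk.Ic (V ε) (RAopt ε) (RBopt ε) - MixedBulk.Ic (V ε) (RA ε) (RB ε))
          =o[𝓝[≠] 0] (fun ε : ℝ => ε ^ 2 * Real.log |ε|) ↔
        MixedBulk.c₁ χ WR = 0)) ∧
    -- smaller `c₁` means larger coherent information
    (∀ (RA RA' : ℝ → MixedBulk.RecA d k) (RB RB' : ℝ → MixedBulk.RecB k)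
        (WR WR' : Matrix (MixedBulk.Idx d k) (MixedBulk.Idx d k) ℂ),
      MixedBulk.IsRecoveryFamily W RA₀ RB₀ RA RB WR →
      MixedBulk.IsRecoveryFamily W RA₀ RB₀ RA' RB' WR' →
      MixedBulk.c₁ χ WR < MixedBulk.c₁ χ WR' →
      ∀ᶠ ε in 𝓝[≠] (0 : ℝ),
        MixedBulk.Ic (V ε) (RA' ε) (RB' ε) < MixedBulk.Ic (V ε) (RA ε) (RB ε)) ∧
    -- every recovery family can be changed locally so that `c₁` vanishes
    (∀ (RA : ℝ → MixedBulk.RecA d k) (RB : ℝ → MixedBulk.RecB k)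
        (WR : Matrix (MixedBulk.Idx d k) (MixedBulk.Idx d k) ℂ),
      MixedBulk.IsRecoveryFamily W RA₀ RB₀ RA RB WR →
      ∃ (O : Matrix (MixedBulk.IdxA d k) (MixedBulk.IdxA d k) ℂ)
        (RA' : ℝ → MixedBulk.RecA d k),
        O.IsHermitian ∧
        (∀ ε, (RA' ε : Matrix (MixedBulk.IdxA d k) (MixedBulk.IdxA d k) ℂ) =
          MixedBulk.expI O ε * (RA ε : Matrix (MixedBulk.IdxA d k) (MixedBulk.IdxA d k) ℂ)) ∧
        MixedBulk.IsRecoveryFamily W RA₀ RB₀ RA' RB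
          (WR + Matrix.kroneckerMap (· * ·) O (1 : Matrix (Fin k) (Fin k) ℂ)) ∧
        MixedBulk.c₁ χ (WR + Matrix.kroneckerMap (· * ·) O (1 : Matrix (Fin k) (Fin k) ℂ)) = 0) ∧
    -- `c₂` is the same for all recovery families and all descriptions of the encoding `V`
    (∃ c₂V : ℝ, ∀ (W' : Matrix (MixedBulk.Idx d k) (MixedBulk.Idx d k) ℂ)
        (χ' : Fin k × Fin k → ℂ) (RA₀' : MixedBulk.RecA d k) (RB₀' : MixedBulk.RecB k)
        (RA : ℝ → MixedBulk.RecA d k) (RB : ℝ → MixedBulk.RecB k)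
        (WR : Matrix (MixedBulk.Idx d k) (MixedBulk.Idx d k) ℂ),
      MixedBulk.IsSkewedCode V W' χ' RA₀' RB₀' →
      MixedBulk.IsRecoveryFamily W' RA₀' RB₀' RA RB WR →
      MixedBulk.c₂ χ' WR = c₂V) := by
  have : NeZero d := ⟨by omega⟩
  have : NeZero k := ⟨by omega⟩
  have hα : 0 < ((d : ℝ) ^ 2 - 1) / (d : ℝ) ^ 2 := by
    have h2 : (2 : ℝ) ≤ d := by exact_mod_cast hd
    have : 0 < (d : ℝ) ^ 2 - 1 := by nlinarith
    positivity
  obtain ⟨RAo, RBo, WRo, hRo, hopt, hc₁⟩ := hV.exists_optimal_recovery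
  refine ⟨⟨RAo, RBo, WRo, hRo, hopt, hc₁⟩, ?_, ?_, ?_, ?_⟩
  · intro RA RAopt RB RBopt WR hR hopt'
    have h := (hV.Ic_asymptotics hd hRo).sub (hV.Ic_asymptotics hd hR)
    rw [hc₁, hV.c₂_eq_const hRo, hV.c₂_eq_const hR] at h
    have hI : ∀ ε, MixedBulk.Ic (V ε) (RAopt ε) (RBopt ε) = MixedBulk.Ic (V ε) (RAo ε) (RBo ε) :=
      fun ε => (hopt' ε).Ic_eq (hopt ε)
    simp only [hI]
    -- `c₂` cancels in the difference, so the gap to the optimum is `-α c₁ ε² log|ε|` up to `o(ε²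
    -- log|ε|)`, with `α = (d² - 1)/d²`.
    rw [← neg_eq_zero (a := MixedBulk.c₁ χ WR), ← mul_eq_zero_iff_left hα.ne',
      ← MixedBulk.isLittleO_const_mul_sq_mul_log_iff]
    refine ⟨fun h1 => (h1.sub h).congr_left fun ε => ?_, fun h1 => (h1.add h).congr_left fun ε => ?_⟩
    · ring
    · ring
  · intro RA RA' RB RB' WR WR' hR hR' hlt
    have h := (hV.Ic_asymptotics hd hR).sub (hV.Ic_asymptotics hd hR')
    rw [hV.c₂_eq_const hR, hV.c₂_eq_const hR'] at h
    have hb := h.bound (c := ((d : ℝ) ^ 2 - 1) / (d : ℝ) ^ 2 *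
      (MixedBulk.c₁ χ WR' - MixedBulk.c₁ χ WR) / 2)
      (half_pos (mul_pos hα (sub_pos.2 hlt)))
    filter_upwards [hb, MixedBulk.eventually_log_abs_neg, self_mem_nhdsWithin] with ε h1 h2 h3
    have h3 : ε ≠ 0 := h3
    -- The scale is negative, so the larger coefficient gives the smaller coherent information.
    have hs : ε ^ 2 * Real.log |ε| < 0 := mul_neg_of_pos_of_neg (by positivity) h2
    rw [Real.norm_eq_abs, Real.norm_eq_abs, abs_of_neg hs] at h1
    have h4 := (abs_le.1 h1).1
    have h5 := mul_pos (mul_pos hα (sub_pos.2 hlt)) (neg_pos.2 hs)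
    linarith
  · intro RA RB WR hR
    have hO := MixedBulk.neg_half_opJ_isHermitian (χ := χ) hR.hermitian
    refine ⟨-(1 / 2 : ℂ) • MixedBulk.opJ χ WR,
      fun ε => ⟨_, MixedBulk.expI_mem_unitaryGroup hO ε⟩ * RA ε, hO, fun ε => rfl, ?_,
      MixedBulk.c₁_add_kronecker_one_eq_zero hV.flat hR.hermitian⟩
    exact hR.left_mul hO (Subtype.ext (MixedBulk.expI_zero _)) (MixedBulk.expI_expansion _)
  · refine ⟨MixedBulk.c₂ χ WRo, fun W' χ' RA₀' RB₀' RA RB WR hV' hR => ?_⟩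
    obtain ⟨RAo', RBo', WRo', hRo', hopt', hc₁'⟩ := hV'.exists_optimal_recovery
    rw [hV'.c₂_eq_const hR, ← hV'.c₂_eq_const hRo']
    -- Both descriptions have exactly optimal families with `c₁ = 0`. Their coherent informations
    -- agree, since the maximum depends on `V` alone, so the remaining coefficients, the two values
    -- of `c₂`, agree as well.
    have h := (hV.Ic_asymptotics hd hRo).sub (hV'.Ic_asymptotics hd hRo')
    rw [hc₁, hc₁'] at h
    have hI : ∀ ε, MixedBulk.Ic (V ε) (RAo ε) (RBo ε) = MixedBulk.Ic (V ε) (RAo' ε) (RBo' ε) :=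
      fun ε => (hopt ε).Ic_eq (hopt' ε)
    rw [← sub_eq_zero, ← mul_eq_zero_iff_left hα.ne',
      ← MixedBulk.isLittleO_const_mul_sq_mul_log_iff]
    refine h.congr_left fun ε => ?_
    rw [hI]
    ring
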